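/- Let $M$ be a smooth manifold and let $(\partial\colon E\to G,\triangleright)$ be a Lie crossed module: $G$ and $E$ are (finite-dimensional) Lie groups, $\partial$ is a smooth group morphism, $\triangleright$ is a smooth left action of $G$ on $E$ by automorphisms, and $\partial(X\triangleright e)=X\,\partial(e)X^{-1}$, $\partial(e)\triangleright f=efe^{-1}$ for $X\in G$, $e,f\in E$. Write $\mathfrak g,\mathfrak e$ for the Lie algebras, and also $\partial\colon\mathfrak e\to\mathfrak g$ and $\triangleright$ for the induced linear map and the induced action of $G$ on $\mathfrak e$. A categorical connection on a smooth principal $G$-bundle $\pi\colon P\to M$ (with right action $R_g$ and fundamental vector fields $A^\#$, $A\in\mathfrak g$) is a pair $(\omega,m)$ of a smooth $\mathfrak g$-valued $1$-form $\omega$ and a smooth $\mathfrak e$-valued $2$-form $m$ on $P$ such that, for all $g\in G$, $A\in\mathfrak g$ and vectors $X,Y$ tangent to $P$ at the same point, $$R_g^*\omega=g^{-1}\omega g,\quad \omega(A^\#)=A,\quad R_g^*m=g^{-1}\triangleright m,\quad m(X,Y)=m(X^H,Y^H),\quad \partial(m(X,Y))=\Omega(X,Y),$$ where $X^H=X-\omega(X)^\#$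 is the horizontal part of $X$ and $\Omega(X,Y)=d\omega(X^H,Y^H)$ is the curvature of $\omega$. Its local form with respect to a smooth section $f$ of $P$ over an open set $U\subset M$ is the pair $(f^*\omega,f^*m)$. 1. Let $P\to M$ be a smooth principal $G$-bundle, $\{U_\alpha\}$ an open cover of $M$, $f_\alpha\colon U_\alpha\to P$ smooth sections of $P$, and let $\phi_{\alpha,\beta}\colon U_\alpha\cap U_\beta\to G$ be defined by $f_\alpha(x)\phi_{\alpha,\beta}(x)=f_\beta(x)$. Suppose that for each $\alpha$ we are given smooth forms $\omega_\alpha\in\mathcal A^1(U_\alpha,\mathfrak g)$ and $m_\alpha\in\mathcal A^2(U_\alpha,\mathfrak e)$ with $$\partial(m_\alpha)=d\omega_\alpha+\tfrac12\,\omega_\alpha\wedge^{\mathrm{ad}}\omega_\alpha,$$ where $(\omega_\alpha\wedge^{\mathrm{ad}}\omega_\alpha)(X,Y)=2[\omega_\alpha(X),\omega_\alpha(Y)]$, and that for all $\alpha,\beta$ the following hold on $U_\alpha\cap U_\beta$: $$\omega_\beta(X)=\phi_{\alpha,\beta}^{-1}\,\omega_\alpha(X)\,\phi_{\alpha,\beta}+\phi_{\alpha,\beta}^{-1}\,d\phi_{\alpha,\beta}(X),\qquad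 m_\beta(X,Y)=\phi_{\alpha,\beta}^{-1}\triangleright m_\alpha(X,Y).$$ Then there is a unique categorical connection $(\omega,m)$ on $P$ such that $f_\alpha^*\omega=\omega_\alpha$ and $f_\alpha^*m=m_\alpha$ on $U_\alpha$ for every $\alpha$. 2. Let $\omega_0\in\mathcal A^1(M,\mathfrak g)$ and $m_0\in\mathcal A^2(M,\mathfrak e)$ be smooth forms with $\partial(m_0)=d\omega_0+\tfrac12\,\omega_0\wedge^{\mathrm{ad}}\omega_0$. Then there is a categorical connection on the trivial bundle $M\times G\to M$ whose local form with respect to the section $x\mapsto(x,1)$ is $(\omega_0,m_0)$. -/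

import Mathlib

open Set Topology
open scoped Manifold ContDiff

noncomputable section

namespace CatConn

/-! ### Differential forms on manifolds -/

section Forms

variable {E : Type*} [NormedAddCommGroup E] [NormedSpace ℝ E]
  {H : Type*} [TopologicalSpace H] (I : ModelWithCorners ℝ E H)
  (M : Type*) [TopologicalSpace M] [ChartedSpace H M]
  {E' : Type*} [NormedAddCommGroup E'] [NormedSpace ℝ E']
  {H' : Type*} [TopologicalSpace H'] (I' : ModelWithCorners ℝ E' H')
  {M' : Type*} [TopologicalSpace M'] [ChartedSpace H' M']

/-- A (not necessarily smooth) differential `k`-form on the manifold `M` with values in the normed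
space `V`: an alternating `k`-linear map `(T_x M)^k → V` for each point `x`. -/
abbrev DiffForm (k : ℕ) (V : Type*) [NormedAddCommGroup V] [NormedSpace ℝ V] :=
  (x : M) → TangentSpace I x [⋀^Fin k]→L[ℝ] V

variable {I M I'} {k : ℕ} {V : Type*} [NormedAddCommGroup V] [NormedSpace ℝ V]

/-- The expression of a form in the preferred chart at `x₀`: the pullback of the form under the
inverse of that chart. It is meaningful on the image of the chart. -/
def DiffForm.inChart (η : DiffForm I M k V) (x₀ : M) : E → E [⋀^Fin k]→L[ℝ] V := fun y =>
  (η ((extChartAt I x₀).symm y)).compContinuousLinearMap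
    (mfderiv 𝓘(ℝ, E) I (extChartAt I x₀).symm y : E →L[ℝ] TangentSpace I ((extChartAt I x₀).symm y))

/-- A form is smooth on the open set `U` if all its expressions in charts are smooth there. A form
on the open submanifold `U` is represented by a form on `M` that is smooth on `U`, whose values
outside `U` play no role. -/
def DiffForm.SmoothOn (η : DiffForm I M k V) (U : Set M) : Prop :=
  ∀ x₀ : M, ContDiffOn ℝ ∞ (η.inChart x₀)
    ((extChartAt I x₀).target ∩ (extChartAt I x₀).symm ⁻¹' U)

/-- The exterior derivative of a form on a (boundaryless) manifold, computed at `x` in the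
preferred chart at `x`. The normalisation is
`dη(X, Y) = X η(Y) - Y η(X) - η([X, Y])` for a `1`-form. -/
def DiffForm.d (η : DiffForm I M k V) : DiffForm I M (k + 1) V := fun x =>
  (extDeriv (η.inChart x) (extChartAt I x x)).compContinuousLinearMap
    (mfderiv I 𝓘(ℝ, E) (extChartAt I x) x : TangentSpace I x →L[ℝ] E)

/-- The pullback `f^* η` of a form under a map `f`; it is meaningful at the points where `f` is
differentiable. -/
def DiffForm.pullback (f : M' → M) (η : DiffForm I M k V) : DiffForm I' M' k V := fun x =>
  (η (f x)).compContinuousLinearMap (mfderiv I' I f x)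

end Forms

/-! ### Lie groups and their Lie algebras -/

section LieGroups

/-- The vector space underlying the Lie algebra `T_1 G` (`GroupLieAlgebra I G`) of `G`. As every
tangent space in Mathlib, it is definitionally the model space; written in this form it carries the
norm of the model space, which is needed to speak of smooth vector valued functions. -/
@[nolint unusedArguments]
abbrev LieAlg {E : Type*} [NormedAddCommGroup E] [NormedSpace ℝ E] {H : Type*} [TopologicalSpace H]
    (_I : ModelWithCorners ℝ E H) (G : Type*) [TopologicalSpace G] [ChartedSpace H G] : Type _ := E

variable {E : Type*} [NormedAddCommGroup E] [NormedSpace ℝ E]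
  {H : Type*} [TopologicalSpace H] (I : ModelWithCorners ℝ E H)
  {G : Type*} [TopologicalSpace G] [ChartedSpace H G] [Group G]

/-- The Lie bracket of the Lie algebra of `G` (that of left-invariant vector fields). -/
def lieBr (a b : LieAlg I G) : LieAlg I G :=
  @Bracket.bracket (GroupLieAlgebra I G) (GroupLieAlgebra I G) _ a b

/-- The adjoint action `A ↦ g A g⁻¹` of `g ∈ G` on the Lie algebra of `G`: the derivative at `1` of
the conjugation by `g`. -/
def Ad (g : G) : LieAlg I G →L[ℝ] LieAlg I G :=
  mfderiv I I (fun h : G => g * h * g⁻¹) 1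

/-- The left Maurer-Cartan form: the tangent vector `v` at `g` is sent to `g⁻¹ v`, a vector tangent
to `G` at `g⁻¹ * g = 1`. -/
def leftMC (g : G) : TangentSpace I g →L[ℝ] LieAlg I G :=
  mfderiv I I (fun h : G => g⁻¹ * h) g

end LieGroups

section WedgeAd

variable {E : Type*} [NormedAddCommGroup E] [NormedSpace ℝ E]
  {H : Type*} [TopologicalSpace H] {I : ModelWithCorners ℝ E H}
  {M : Type*} [TopologicalSpace M] [ChartedSpace H M]
  {EG : Type*} [NormedAddCommGroup EG] [NormedSpace ℝ EG]
  {HG : Type*} [TopologicalSpace HG] {IG : ModelWithCorners ℝ EG HG}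
  {G : Type*} [TopologicalSpace G] [ChartedSpace HG G] [Group G]

/-- The values of `a ∧^ad b = 2 Alt (a ⊗^ad b)` for `1`-forms `a`, `b` with values in the Lie
algebra of `G`: `(a ∧^ad b)(X, Y) = [a(X), b(Y)] - [a(Y), b(X)]`. -/
def wedgeAd (a b : DiffForm I M 1 (LieAlg IG G)) (x : M) (X Y : TangentSpace I x) : LieAlg IG G :=
  lieBr (G := G) IG (a x ![X]) (b x ![Y]) - lieBr (G := G) IG (a x ![Y]) (b x ![X])

/-- The values of `dη + ½ η ∧^ad η` for a `1`-form `η` with values in the Lie algebra of `G`. -/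
def localCurvature (η : DiffForm I M 1 (LieAlg IG G)) (x : M) (X Y : TangentSpace I x) :
    LieAlg IG G :=
  η.d x ![X, Y] + (1 / 2 : ℝ) • wedgeAd (IG := IG) (G := G) η η x X Y

end WedgeAd

/-! ### Lie crossed modules -/

section CrossedModules

variable {EG : Type*} [NormedAddCommGroup EG] [NormedSpace ℝ EG]
  {HG : Type*} [TopologicalSpace HG] (IG : ModelWithCorners ℝ EG HG)
  (G : Type*) [TopologicalSpace G] [ChartedSpace HG G] [Group G]
  {EK : Type*} [NormedAddCommGroup EK] [NormedSpace ℝ EK]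
  {HK : Type*} [TopologicalSpace HK] (IK : ModelWithCorners ℝ EK HK)
  (K : Type*) [TopologicalSpace K] [ChartedSpace HK K] [Group K]

/-- A Lie crossed module `(∂ : K → G, ▷)`: a smooth group morphism `∂ : K → G` and a smooth left
action `▷` of `G` on `K` by automorphisms with `∂(X ▷ e) = X ∂(e) X⁻¹` and `∂(e) ▷ f = e f e⁻¹`. -/
structure LieCrossedModule where
  /-- the morphism `∂ : K → G` -/
  bd : K →* G
  /-- the action `▷` of `G` on `K` by automorphisms -/
  act : G →* MulAut K
  contMDiff_bd : ContMDiff IK IG ∞ bd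
  contMDiff_act : ContMDiff (IG.prod IK) IK ∞ (fun q : G × K => act q.1 q.2)
  bd_act : ∀ (X : G) (e : K), bd (act X e) = X * bd e * X⁻¹
  act_bd : ∀ e f : K, act (bd e) f = e * f * e⁻¹

variable {IG G IK K}

/-- The induced map `∂` between Lie algebras: the derivative of `∂ : K → G` at `1`. -/
def LieCrossedModule.dBd (𝒢 : LieCrossedModule IG G IK K) : LieAlg IK K →L[ℝ] LieAlg IG G :=
  mfderiv IK IG 𝒢.bd 1

/-- The induced action `e ↦ g ▷ e` of `g ∈ G` on the Lie algebra of `K`: the derivative at `1` of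
the automorphism `g ▷ -` of `K`. -/
def LieCrossedModule.dAct (𝒢 : LieCrossedModule IG G IK K) (g : G) :
    LieAlg IK K →L[ℝ] LieAlg IK K :=
  mfderiv IK IK (fun e : K => 𝒢.act g e) 1

end CrossedModules

/-! ### Principal bundles -/

section Bundles

variable {EM : Type*} [NormedAddCommGroup EM] [NormedSpace ℝ EM]
  {HM : Type*} [TopologicalSpace HM] (IM : ModelWithCorners ℝ EM HM)
  (M : Type*) [TopologicalSpace M] [ChartedSpace HM M]
  {EP : Type*} [NormedAddCommGroup EP] [NormedSpace ℝ EP]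
  {HP : Type*} [TopologicalSpace HP] (IP : ModelWithCorners ℝ EP HP)
  (P : Type*) [TopologicalSpace P] [ChartedSpace HP P]
  {EG : Type*} [NormedAddCommGroup EG] [NormedSpace ℝ EG]
  {HG : Type*} [TopologicalSpace HG] (IG : ModelWithCorners ℝ EG HG)
  (G : Type*) [TopologicalSpace G] [ChartedSpace HG G] [Group G]

/-- The structure of a smooth principal `G`-bundle over `M` on the manifold `P`: a smooth projection
`π : P → M` and a smooth right action of `G` on `P`, which are locally, over open sets `U` covering
`M`, equivariantly diffeomorphic to the product `U × G`. -/
structure PrincipalBundle where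
  /-- the projection `π : P → M` -/
  proj : P → M
  /-- the right action `(p, g) ↦ p g` of `G` on `P` -/
  act : P → G → P
  act_one : ∀ p, act p 1 = p
  act_mul : ∀ p g h, act p (g * h) = act (act p g) h
  proj_act : ∀ p g, proj (act p g) = proj p
  contMDiff_proj : ContMDiff IP IM ∞ proj
  contMDiff_act : ContMDiff (IP.prod IG) IP ∞ (fun q : P × G => act q.1 q.2)
  exists_triv : ∀ x : M, ∃ (U : Set M) (Φ : OpenPartialHomeomorph P (M × G)),
    IsOpen U ∧ x ∈ U ∧ Φ.source = proj ⁻¹' U ∧ Φ.target = U ×ˢ (univ : Set G) ∧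
    ContMDiffOn IP (IM.prod IG) ∞ Φ Φ.source ∧
    ContMDiffOn (IM.prod IG) IP ∞ Φ.symm Φ.target ∧
    (∀ p ∈ Φ.source, (Φ p).1 = proj p) ∧
    (∀ p ∈ Φ.source, ∀ g : G, Φ (act p g) = ((Φ p).1, (Φ p).2 * g))

/-- The trivial principal bundle `M × G → M`, with `(x, h) g = (x, h g)`. -/
def trivialBundle [LieGroup IG ∞ G] : PrincipalBundle IM M (IM.prod IG) (M × G) IG G where
  proj := Prod.fst
  act p g := (p.1, p.2 * g)
  act_one p := by simp
  act_mul p g h := by simp [mul_assoc]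
  proj_act p g := rfl
  contMDiff_proj := contMDiff_fst
  contMDiff_act :=
    (contMDiff_fst.comp contMDiff_fst).prodMk
      ((contMDiff_snd.comp contMDiff_fst).mul contMDiff_snd)
  exists_triv x := ⟨univ, OpenPartialHomeomorph.refl _, isOpen_univ, mem_univ x, by simp, by simp,
    contMDiffOn_id, contMDiffOn_id, fun _ _ => rfl, fun _ _ _ => rfl⟩

variable {IM M IP P IG G}

/-- The value `A^#_p` at `p` of the fundamental vector field of `A` in the Lie algebra of `G`: the
image of `A` under the derivative at `1` of the orbit map `g ↦ p g`, that is, the velocity at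
`t = 0` of `t ↦ p exp(tA)`. -/
def PrincipalBundle.fund (B : PrincipalBundle IM M IP P IG G) (p : P) :
    LieAlg IG G →L[ℝ] TangentSpace IP p :=
  mfderiv IG IP (fun g : G => B.act p g) 1

/-- The horizontal part `X^H = X - (η(X))^#` of a tangent vector `X` to `P` with respect to a
connection `1`-form `η`. -/
def PrincipalBundle.hor (B : PrincipalBundle IM M IP P IG G)
    (η : DiffForm IP P 1 (LieAlg IG G)) (p : P) (X : TangentSpace IP p) : TangentSpace IP p :=
  X - B.fund p (η p ![X])

variable {EK : Type*} [NormedAddCommGroup EK] [NormedSpace ℝ EK]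
  {HK : Type*} [TopologicalSpace HK] {IK : ModelWithCorners ℝ EK HK}
  {K : Type*} [TopologicalSpace K] [ChartedSpace HK K] [Group K]

/-- A `𝒢`-categorical connection on the principal `G`-bundle `P`. -/
@[ext]
structure CategoricalConnection (𝒢 : LieCrossedModule IG G IK K)
    (B : PrincipalBundle IM M IP P IG G) where
  /-- the connection `1`-form -/
  η : DiffForm IP P 1 (LieAlg IG G)
  /-- the `2`-form -/
  m : DiffForm IP P 2 (LieAlg IK K)
  smooth_η : η.SmoothOn univ
  smooth_m : m.SmoothOn univ
  /-- `R_g^* η = g⁻¹ η g` -/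
  equivariant_η : ∀ (g : G) (p : P) (X : TangentSpace IP p),
    DiffForm.pullback (I' := IP) (fun q : P => B.act q g) η p ![X] = Ad IG g⁻¹ (η p ![X])
  /-- `η(A^#) = A` -/
  η_fund : ∀ (p : P) (A : LieAlg IG G), η p ![B.fund p A] = A
  /-- `R_g^* m = g⁻¹ ▷ m` -/
  equivariant_m : ∀ (g : G) (p : P) (X Y : TangentSpace IP p),
    DiffForm.pullback (I' := IP) (fun q : P => B.act q g) m p ![X, Y] = 𝒢.dAct g⁻¹ (m p ![X, Y])
  /-- `m(X, Y) = m(X^H, Y^H)` -/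
  horizontal_m : ∀ (p : P) (X Y : TangentSpace IP p),
    m p ![X, Y] = m p ![B.hor η p X, B.hor η p Y]
  /-- `∂(m) = Ω`, where the curvature of `η` is `Ω(X, Y) = dη(X^H, Y^H)` -/
  bd_m : ∀ (p : P) (X Y : TangentSpace IP p),
    𝒢.dBd (m p ![X, Y]) = η.d p ![B.hor η p X, B.hor η p Y]

/-- The forms `η₀`, `m₀` are, on the open set `U`, the local form `(f^* η, f^* m)` of the
categorical connection `(η, m)` with respect to the section `f` of `P` over `U`. -/
def CategoricalConnection.HasLocalForm {𝒢 : LieCrossedModule IG G IK K}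
    {B : PrincipalBundle IM M IP P IG G} (c : CategoricalConnection 𝒢 B) (U : Set M) (f : M → P)
    (η₀ : DiffForm IM M 1 (LieAlg IG G)) (m₀ : DiffForm IM M 2 (LieAlg IK K)) : Prop :=
  ∀ x ∈ U, DiffForm.pullback (I' := IM) f c.η x = η₀ x ∧ DiffForm.pullback (I' := IM) f c.m x = m₀ x

end Bundles

end CatConn

end

/-! A section `f` over `U` gives every point over `U` a fibre coordinate `g = B.coord f`, determined
by `p = f (π p) g(p)`. Differentiating this identity splits each tangent vector at `p` into a
translate of a vector tangent to the section and a fundamental vector. Equivariance fixes a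
connection on the first summand; on the second `η` is normalised and `m` is blind to it. So the
local form `(η₀, m₀)` forces `η = g⁻¹ (π^* η₀) g + g⁻¹ dg` and `m = g⁻¹ ▷ π^* m₀`, the forms
`liftOne` and `liftTwo`. This is uniqueness (`η_eq_liftOne`, `m_eq_liftTwo`).

For existence, these formulas serve as definitions. Two sections with `f' = f φ` have coordinates
related by `g = φ g'`, and the compatibility conditions say exactly that the two lifts then agree
(`liftOne_transition`, `liftTwo_transition`). The axioms of a categorical connection are local over
the base, so they need checking only for one lift.

The substantial axiom is `∂(m) = Ω`. It rests on `structure_equation`: if `ψ = N⁻¹ ν N + N⁻¹ dN`,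
then `dψ + [ψ, ψ]` is the conjugate by `N⁻¹` of `dν + [ν, ν]`, where `[ψ, ψ](u, v) = [ψ u, ψ v]`. On
horizontal vectors the bracket of the lifted form vanishes, and `∂(g ▷ x) = g ∂(x) g⁻¹` finishes.
The structure equation follows from the Maurer-Cartan equation (`extDeriv_plot_maurerCartan`) and
two consequences of it: the invariance of the bracket under `Ad` and the derivative of `Ad (N⁻¹)`.

Calculus is done on vector spaces: a form is studied through its plots, that is, its pullbacks along
maps from a vector space, and `DiffForm.extDeriv_plot` moves exterior derivatives between the two
settings. -/

noncomputable section

namespace CatConn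

/-! ### Smooth families of alternating maps on finite-dimensional spaces -/

section
variable {W : Type*} [NormedAddCommGroup W] [NormedSpace ℝ W]
  {F : Type*} [NormedAddCommGroup F] [NormedSpace ℝ F] [FiniteDimensional ℝ F]
  {F' : Type*} [NormedAddCommGroup F'] [NormedSpace ℝ F'] [FiniteDimensional ℝ F']
  {V : Type*} [NormedAddCommGroup V] [NormedSpace ℝ V] [FiniteDimensional ℝ V]
  {V' : Type*} [NormedAddCommGroup V'] [NormedSpace ℝ V'] [FiniteDimensional ℝ V']
  {n : WithTop ℕ∞} {k : ℕ}

instance finiteDimensional_continuousMultilinearMap :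
    FiniteDimensional ℝ (ContinuousMultilinearMap ℝ (fun _ : Fin k => F) V) :=
  FiniteDimensional.of_injective
    (ContinuousMultilinearMap.toMultilinearMapLinear :
      ContinuousMultilinearMap ℝ (fun _ : Fin k => F) V →ₗ[ℝ] _)
    ContinuousMultilinearMap.toMultilinearMap_injective

/-- The inclusion of alternating into multilinear maps is injective, so it has a linear left
inverse, which is continuous because the space of multilinear maps is finite-dimensional. Smoothness
of compositions can thus be checked on multilinear maps. -/
theorem contDiffAt_toContinuousMultilinearMap_iff {f : W → F [⋀^Fin k]→L[ℝ] V} {w : W} :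
    ContDiffAt ℝ n (fun x => (f x).toContinuousMultilinearMap) w ↔ ContDiffAt ℝ n f w := by
  set L : (F [⋀^Fin k]→L[ℝ] V) →L[ℝ] _ :=
    ContinuousAlternatingMap.toContinuousMultilinearMapCLM ℝ with hL
  refine ⟨fun h => ?_, fun h => L.contDiff.contDiffAt.comp w h⟩
  have hinj : Function.Injective L :=
    ContinuousAlternatingMap.toContinuousMultilinearMap_injective
  obtain ⟨R, hR⟩ := LinearMap.exists_leftInverse_of_injective L.toLinearMap
    (LinearMap.ker_eq_bot.2 hinj)
  have : f = fun x => LinearMap.toContinuousLinearMap R (f x).toContinuousMultilinearMap :=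
    funext fun x => (LinearMap.congr_fun hR (f x)).symm
  rw [this]
  exact (LinearMap.toContinuousLinearMap R).contDiff.contDiffAt.comp w h

theorem _root_.ContDiffAt.alternating_compContinuousLinearMap {f : W → F [⋀^Fin k]→L[ℝ] V}
    {g : W → F' →L[ℝ] F} {w : W} (hf : ContDiffAt ℝ n f w) (hg : ContDiffAt ℝ n g w) :
    ContDiffAt ℝ n (fun x => (f x).compContinuousLinearMap (g x)) w := by
  rw [← contDiffAt_toContinuousMultilinearMap_iff] at hf ⊢
  exact ((ContinuousMultilinearMap.compContinuousLinearMapContinuousMultilinear ℝ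
    (fun _ : Fin k => F') (fun _ => F) V).contDiff.contDiffAt.comp w
      (contDiffAt_pi.2 fun _ => hg)).clm_apply hf

theorem _root_.ContDiffAt.compContinuousAlternatingMap {f : W → F [⋀^Fin k]→L[ℝ] V}
    {g : W → V →L[ℝ] V'} {w : W} (hf : ContDiffAt ℝ n f w) (hg : ContDiffAt ℝ n g w) :
    ContDiffAt ℝ n (fun x => (g x).compContinuousAlternatingMap (f x)) w := by
  rw [← contDiffAt_toContinuousMultilinearMap_iff] at hf ⊢
  exact ((ContinuousLinearMap.compContinuousMultilinearMapL ℝ (fun _ : Fin k => F) V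
    V').contDiff.contDiffAt.comp w hg).clm_apply hf

omit [FiniteDimensional ℝ V] in
theorem extDeriv_one_apply {α : W → W [⋀^Fin 1]→L[ℝ] V} {w : W} (h : DifferentiableAt ℝ α w)
    (u v : W) : extDeriv α w ![u, v] =
      fderiv ℝ (fun x => α x ![v]) w u - fderiv ℝ (fun x => α x ![u]) w v := by
  rw [extDeriv_apply h, Fin.sum_univ_two]
  have h0 : (0 : Fin 2).removeNth ![u, v] = ![v] := by ext i; fin_cases i; rfl
  have h1 : (1 : Fin 2).removeNth ![u, v] = ![u] := by ext i; fin_cases i; rfl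
  rw [h0, h1]; simp [sub_eq_add_neg]

omit [FiniteDimensional ℝ F] [FiniteDimensional ℝ V] in
theorem _root_.DifferentiableAt.alternating_apply_const {α : W → F [⋀^Fin k]→L[ℝ] V}
    {w : W} (h : DifferentiableAt ℝ α w)
    (v : Fin k → F) : DifferentiableAt ℝ (fun x => α x v) w := 
  (ContinuousAlternatingMap.apply ℝ F V v).differentiableAt.comp w h
end

/-! ### Differential forms seen through their plots -/

section Forms
variable {E : Type*} [NormedAddCommGroup E] [NormedSpace ℝ E] 
  {H : Type*} [TopologicalSpace H] {I : ModelWithCorners ℝ E H}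
  {M : Type*} [TopologicalSpace M] [ChartedSpace H M]
  {E' : Type*} [NormedAddCommGroup E'] [NormedSpace ℝ E']
  {H' : Type*} [TopologicalSpace H'] {I' : ModelWithCorners ℝ E' H'}
  {M' : Type*} [TopologicalSpace M'] [ChartedSpace H' M'] 
  {E'' : Type*} [NormedAddCommGroup E''] [NormedSpace ℝ E'']
  {H'' : Type*} [TopologicalSpace H''] {I'' : ModelWithCorners ℝ E'' H''}
  {M'' : Type*} [TopologicalSpace M''] [ChartedSpace H'' M'']
  {W : Type*} [NormedAddCommGroup W] [NormedSpace ℝ W]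
  {k : ℕ} {V : Type*} [NormedAddCommGroup V] [NormedSpace ℝ V]

theorem DiffForm.pullback_pullback (η : DiffForm I M k V) {f : M' → M} {g : M'' → M'} {x : M''}
    (hf : MDifferentiableAt I' I f (g x)) (hg : MDifferentiableAt I'' I' g x) :
    DiffForm.pullback (I' := I'') g (DiffForm.pullback (I' := I') f η) x =
      DiffForm.pullback (I' := I'') (f ∘ g) η x := by
  simp only [DiffForm.pullback]
  rw [mfderiv_comp x hf hg]
  rfl

theorem DiffForm.pullback_congr (η : DiffForm I M k V) {f g : M' → M} {x : M'} (h : f =ᶠ[𝓝 x] g) :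
    DiffForm.pullback (I' := I') f η x = DiffForm.pullback (I' := I') g η x := by
  ext v
  simp only [DiffForm.pullback]
  rw [h.mfderiv_eq, h.eq_of_nhds]

/-- The pullback of a form under a map from a vector space, as a function on the vector space. -/
def DiffForm.plot (N : W → M) (η : DiffForm I M k V) : W → W [⋀^Fin k]→L[ℝ] V :=
  DiffForm.pullback (I' := 𝓘(ℝ, W)) N η

/-- Near `w` the map `N` factors through the chart at `N w`, so the pullback can be taken in two
steps, the second between vector spaces. Smoothness of plots and naturality of `d` both reduce to
this. -/
theorem DiffForm.plot_eventuallyEq [IsManifold I ∞ M] [I.Boundaryless] (η : DiffForm I M k V)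
    (N : W → M) {w : W}
    (hN : ContMDiffAt 𝓘(ℝ, W) I ∞ N w) :
    η.plot N =ᶠ[𝓝 w] fun y => (η.inChart (N w) (extChartAt I (N w) (N y))).compContinuousLinearMap
      (fderiv ℝ (extChartAt I (N w) ∘ N) y) := by
  have h1 := (contMDiffAt_iff_contMDiffAt_nhds (by simp)).1 (hN.of_le (m := 1) (by simp))
  have h2 := hN.continuousAt.preimage_mem_nhds (extChartAt_source_mem_nhds (I := I) (N w))
  filter_upwards [h1, eventually_eventually_nhds.2 h2] with y hy hy2
  have hy3 := hy2.self_of_nhds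
  have hs : MDifferentiableAt 𝓘(ℝ, E) I (extChartAt I (N w)).symm (extChartAt I (N w) (N y)) := by
    have := ((contMDiffOn_extChartAt_symm (I := I) (n := ∞) (N w)).contMDiffAt
      ((isOpen_extChartAt_target (I := I) (N w)).mem_nhds ((extChartAt I (N w)).map_source hy3)))
    exact this.mdifferentiableAt (by simp)
  have hc : MDifferentiableAt 𝓘(ℝ, W) 𝓘(ℝ, E) (extChartAt I (N w) ∘ N) y :=
    ((contMDiffAt_extChartAt' (I := I) (n := 1) (by simpa using hy3)).comp y
      hy).mdifferentiableAt (by simp)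
  have e : N =ᶠ[𝓝 y] (extChartAt I (N w)).symm ∘ (extChartAt I (N w) ∘ N) := by
    filter_upwards [hy2] with z hz
    exact ((extChartAt I (N w)).left_inv hz).symm
  refine Eq.trans (DiffForm.pullback_congr η e)
    ((DiffForm.pullback_pullback η (g := extChartAt I (N w) ∘ N) hs hc).symm.trans ?_)
  rw [← mfderiv_eq_fderiv]
  rfl

theorem DiffForm.SmoothOn.contDiffAt_plot [IsManifold I ∞ M] [I.Boundaryless]
    [FiniteDimensional ℝ E] [FiniteDimensional ℝ W]
    [FiniteDimensional ℝ V] {η : DiffForm I M k V} {U : Set M} (hη : η.SmoothOn U) (hU : IsOpen U)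
    {N : W → M} {w : W} (hN : ContMDiffAt 𝓘(ℝ, W) I ∞ N w) (hw : N w ∈ U) :
    ContDiffAt ℝ ∞ (η.plot N) w := by
  refine ContDiffAt.congr_of_eventuallyEq ?_ (η.plot_eventuallyEq N hN)
  have hc : ContDiffAt ℝ ∞ (extChartAt I (N w) ∘ N) w := 
    ((contMDiffAt_extChartAt (I := I)).comp w hN).contDiffAt
  have ht := mem_extChartAt_target (I := I) (N w)
  have hi : ContDiffAt ℝ ∞ (η.inChart (N w)) (extChartAt I (N w) (N w)) := by
    refine (hη (N w)).contDiffAt (Filter.inter_mem (extChartAt_target_mem_nhds (I := I) (N w)) ?_)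
    exact (continuousAt_extChartAt_symm (I := I) (N w)).preimage_mem_nhds
      (hU.mem_nhds (by simpa using hw))
  exact (hi.comp w hc).alternating_compContinuousLinearMap (hc.fderiv_right (m := ∞) (by simp))

theorem DiffForm.smoothOn_of_contDiffAt {η : DiffForm I M k V} {U : Set M} 
    (h : ∀ x₀ : M, ∀ y ∈ (extChartAt I x₀).target, (extChartAt I x₀).symm y ∈ U →
      ContDiffAt ℝ ∞ (η.plot (extChartAt I x₀).symm) y) :
    η.SmoothOn U := fun x₀ y hy => (h x₀ y hy.1 hy.2).contDiffWithinAt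

/-- Naturality of `d` on vector spaces, applied to the chart expression of `N`. No immersion
hypothesis on `N` is needed, so it also covers maps such as fibre coordinates. -/
theorem DiffForm.extDeriv_plot [IsManifold I ∞ M] [I.Boundaryless] [FiniteDimensional ℝ E]
    [FiniteDimensional ℝ V] {η : DiffForm I M k V} {U : Set M} (hη : η.SmoothOn U) (hU : IsOpen U)
    {N : W → M} {w : W} (hN : ContMDiffAt 𝓘(ℝ, W) I ∞ N w) (hw : N w ∈ U) :
    extDeriv (η.plot N) w = η.d.plot N w := by
  have hc : ContDiffAt ℝ ∞ (extChartAt I (N w) ∘ N) w := 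
    ((contMDiffAt_extChartAt (I := I)).comp w hN).contDiffAt
  have hi : ContDiffAt ℝ ∞ (η.inChart (N w)) (extChartAt I (N w) (N w)) := by
    refine (hη (N w)).contDiffAt (Filter.inter_mem (extChartAt_target_mem_nhds (I := I) (N w)) ?_)
    exact (continuousAt_extChartAt_symm (I := I) (N w)).preimage_mem_nhds
      (hU.mem_nhds (by simpa using hw))
  rw [(η.plot_eventuallyEq N hN).extDeriv_eq]
  refine (extDeriv_pullback (f := extChartAt I (N w) ∘ N) (hi.differentiableAt (by simp)) hc
    (by simpa using ENat.LEInfty.out)).trans ?_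
  simp only [DiffForm.plot, DiffForm.pullback, DiffForm.d]
  rw [← mfderiv_eq_fderiv, mfderiv_comp w
    ((contMDiffAt_extChartAt (I := I) (n := ∞)).mdifferentiableAt (by simp))
    (hN.mdifferentiableAt (by simp))]
  rfl

theorem DiffForm.d_congr {η η' : DiffForm I M k V} [I.Boundaryless] {x : M}
    (h : ∀ᶠ y in 𝓝 x, η y = η' y) : η.d x = η'.d x := by
  have : η.inChart x =ᶠ[𝓝 (extChartAt I x x)] η'.inChart x := by
    have := (continuousAt_extChartAt_symm (I := I) x).tendsto.eventually (by simpa using h)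
    filter_upwards [this] with y hy
    simp only [DiffForm.inChart, hy]
  simp only [DiffForm.d, this.extDeriv_eq]

end Forms

/-! ### Derivatives of maps of manifolds as maps of model spaces -/

section Partial
variable
  {E₁ : Type*} [NormedAddCommGroup E₁] [NormedSpace ℝ E₁] {H₁ : Type*} [TopologicalSpace H₁]
  {I₁ : ModelWithCorners ℝ E₁ H₁} {M₁ : Type*} [TopologicalSpace M₁] [ChartedSpace H₁ M₁]
  {E₂ : Type*} [NormedAddCommGroup E₂] [NormedSpace ℝ E₂] {H₂ : Type*} [TopologicalSpace H₂]
  {I₂ : ModelWithCorners ℝ E₂ H₂} {M₂ : Type*} [TopologicalSpace M₂] [ChartedSpace H₂ M₂]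
  {E₃ : Type*} [NormedAddCommGroup E₃] [NormedSpace ℝ E₃] {H₃ : Type*} [TopologicalSpace H₃]
  {I₃ : ModelWithCorners ℝ E₃ H₃} {M₃ : Type*} [TopologicalSpace M₃] [ChartedSpace H₃ M₃]
  {E₄ : Type*} [NormedAddCommGroup E₄] [NormedSpace ℝ E₄] {H₄ : Type*} [TopologicalSpace H₄]
  {I₄ : ModelWithCorners ℝ E₄ H₄} {M₄ : Type*} [TopologicalSpace M₄] [ChartedSpace H₄ M₄]
  {W : Type*} [NormedAddCommGroup W] [NormedSpace ℝ W]

variable (I₁ I₂) in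
/-- The derivative of a map of manifolds, as a linear map between the model spaces. -/
def tderiv (f : M₁ → M₂) (x : M₁) : E₁ →L[ℝ] E₂ := mfderiv I₁ I₂ f x

theorem tderiv_id (x : M₁) : tderiv I₁ I₁ (fun z => z) x = ContinuousLinearMap.id ℝ E₁ :=
  mfderiv_id

theorem tderiv_const (c : M₂) (x : M₁) : tderiv I₁ I₂ (fun _ => c) x = 0 :=
  mfderiv_const

theorem tderiv_congr {f g : M₁ → M₂} {x : M₁} (h : f =ᶠ[𝓝 x] g) :
    tderiv I₁ I₂ f x = tderiv I₁ I₂ g x :=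
  h.mfderiv_eq

theorem tderiv_comp_of_eq {g : M₂ → M₃} {f : M₁ → M₂} {x : M₁} {y : M₂}
    (hg : MDifferentiableAt I₂ I₃ g y) (hf : MDifferentiableAt I₁ I₂ f x) (h : f x = y) :
    tderiv I₁ I₃ (fun z => g (f z)) x = (tderiv I₂ I₃ g y).comp (tderiv I₁ I₂ f x) := by
  subst h
  exact mfderiv_comp x hg hf

theorem tderiv_comp {g : M₂ → M₃} {f : M₁ → M₂} {x : M₁}
    (hg : MDifferentiableAt I₂ I₃ g (f x)) (hf : MDifferentiableAt I₁ I₂ f x) (v : E₁) :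
    tderiv I₁ I₃ (fun z => g (f z)) x v = tderiv I₂ I₃ g (f x) (tderiv I₁ I₂ f x v) := by
  rw [tderiv_comp_of_eq hg hf rfl]; rfl

theorem tderiv_comp₂ {Φ : M₁ × M₂ → M₃} {a : M₄ → M₁} {b : M₄ → M₂} {x : M₄}
    (hΦ : MDifferentiableAt (I₁.prod I₂) I₃ Φ (a x, b x)) (ha : MDifferentiableAt I₄ I₁ a x)
    (hb : MDifferentiableAt I₄ I₂ b x) (v : E₄) :
    tderiv I₄ I₃ (fun z => Φ (a z, b z)) x v =
      tderiv I₄ I₃ (fun z => Φ (a z, b x)) x v + tderiv I₄ I₃ (fun z => Φ (a x, b z)) x v := by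
  have h1 : MDifferentiableAt I₁ I₃ (fun p => Φ (p, b x)) (a x) :=
    MDifferentiableAt.comp (a x) (I' := I₁.prod I₂) hΦ
      (mdifferentiableAt_id.prodMk mdifferentiableAt_const)
  have h2 : MDifferentiableAt I₂ I₃ (fun q => Φ (a x, q)) (b x) :=
    MDifferentiableAt.comp (b x) (I' := I₁.prod I₂) hΦ
      (mdifferentiableAt_const.prodMk mdifferentiableAt_id)
  rw [tderiv_comp (f := fun z => (a z, b z)) hΦ (ha.prodMk hb),
    tderiv_comp (g := fun p => Φ (p, b x)) h1 ha, tderiv_comp (g := fun q => Φ (a x, q)) h2 hb]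
  have : tderiv I₄ (I₁.prod I₂) (fun z => (a z, b z)) x =
      (tderiv I₄ I₁ a x).prod (tderiv I₄ I₂ b x) := mfderiv_prodMk ha hb
  rw [this]
  exact mfderiv_prod_eq_add_apply hΦ

theorem tderiv_eq_fderiv [I₁.Boundaryless] {f : M₁ → M₂} {x : M₁} (hf : MDifferentiableAt I₁ I₂ f x) :
    tderiv I₁ I₂ f x =
      fderiv ℝ (fun s => extChartAt I₂ (f x) (f ((extChartAt I₁ x).symm s))) (extChartAt I₁ x x) := by
  refine (if_pos hf).trans ?_
  rw [I₁.range_eq_univ, fderivWithin_univ]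
  rfl

theorem contMDiffAt_extChartAt_symm [I₁.Boundaryless] [IsManifold I₁ ∞ M₁] (x : M₁) {y : E₁}
    (hy : y ∈ (extChartAt I₁ x).target) :
    ContMDiffAt 𝓘(ℝ, E₁) I₁ ∞ (extChartAt I₁ x).symm y :=
  (contMDiffOn_extChartAt_symm (I := I₁) x).contMDiffAt
    ((isOpen_extChartAt_target (I := I₁) x).mem_nhds hy)

/-- Since `F (a, y) = c` for all `a`, every derivative in the family is read in the same two charts,
at `y` and at `c`. It is then an ordinary parametric derivative. With a moving value the preferred
target chart could jump. This gives smoothness of `Ad` and of the action on the Lie algebra of `K`,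
both derivatives at the fixed point `1`. -/
theorem contDiffAt_tderiv_family [I₂.Boundaryless] [IsManifold I₂ ∞ M₂] [IsManifold I₃ ∞ M₃]
    {F : M₁ × M₂ → M₃} (hF : ContMDiff (I₁.prod I₂) I₃ ∞ F) {y : M₂} {c : M₃}
    (hc : ∀ a, F (a, y) = c) {N : W → M₁} {w : W} (hN : ContMDiffAt 𝓘(ℝ, W) I₁ ∞ N w) :
    ContDiffAt ℝ ∞ (fun w => tderiv I₂ I₃ (fun b => F (N w, b)) y) w := by
  have key : ∀ w, tderiv I₂ I₃ (fun b => F (N w, b)) y =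
      fderiv ℝ (fun s => extChartAt I₃ c (F (N w, (extChartAt I₂ y).symm s)))
        (extChartAt I₂ y y) := by
    intro w
    have : MDifferentiableAt I₂ I₃ (fun b => F (N w, b)) y :=
      MDifferentiableAt.comp y (I' := I₁.prod I₂) (hF.mdifferentiableAt (by simp))
        (mdifferentiableAt_const.prodMk mdifferentiableAt_id)
    rw [tderiv_eq_fderiv this, hc]
  simp_rw [key]
  refine ContDiffAt.fderiv (n := ∞) (m := ∞)
    (f := fun z s => extChartAt I₃ c (F (N z, (extChartAt I₂ y).symm s)))
    (g := fun _ => extChartAt I₂ y y) ?_ contDiffAt_const (by simp)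
  rw [← contMDiffAt_iff_contDiffAt]
  have hs : ContMDiffAt 𝓘(ℝ, E₂) I₂ ∞ (extChartAt I₂ y).symm (extChartAt I₂ y y) :=
    contMDiffAt_extChartAt_symm y (mem_extChartAt_target y)
  have hch : ContMDiffAt I₃ 𝓘(ℝ, E₃) ∞ (extChartAt I₃ c)
      (F (N w, (extChartAt I₂ y).symm (extChartAt I₂ y y))) := by
    rw [extChartAt_to_inv, hc]; exact contMDiffAt_extChartAt
  have h1 : ContMDiffAt 𝓘(ℝ, W × E₂) (I₁.prod I₂) ∞
      (fun p : W × E₂ => (N p.1, (extChartAt I₂ y).symm p.2)) (w, extChartAt I₂ y y) :=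
    ContMDiffAt.prodMk
      (ContMDiffAt.comp (w, extChartAt I₂ y y) (I' := 𝓘(ℝ, W)) (g := N) hN
        contDiff_fst.contMDiff.contMDiffAt)
      (ContMDiffAt.comp (w, extChartAt I₂ y y) (I' := 𝓘(ℝ, E₂)) (g := (extChartAt I₂ y).symm) hs
        contDiff_snd.contMDiff.contMDiffAt)
  exact ContMDiffAt.comp (w, extChartAt I₂ y y) hch
    (ContMDiffAt.comp (w, extChartAt I₂ y y) hF.contMDiffAt h1)
end Partial

/-! ### The Maurer-Cartan form and left logarithmic derivatives -/

section Lie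
variable {EG : Type*} [NormedAddCommGroup EG] [NormedSpace ℝ EG]
  {HG : Type*} [TopologicalSpace HG] {IG : ModelWithCorners ℝ EG HG}
  {G : Type*} [TopologicalSpace G] [ChartedSpace HG G] [Group G]
  {E : Type*} [NormedAddCommGroup E] [NormedSpace ℝ E] {H : Type*} [TopologicalSpace H]
  {I : ModelWithCorners ℝ E H} {M : Type*} [TopologicalSpace M] [ChartedSpace H M]
  {E' : Type*} [NormedAddCommGroup E'] [NormedSpace ℝ E'] {H' : Type*} [TopologicalSpace H']
  {I' : ModelWithCorners ℝ E' H'} {M' : Type*} [TopologicalSpace M'] [ChartedSpace H' M']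
  {W : Type*} [NormedAddCommGroup W] [NormedSpace ℝ W]

variable (IG G) in
/-- The left Maurer-Cartan form as a `1`-form. -/
def maurerCartan : DiffForm IG G 1 (LieAlg IG G) := fun g =>
  ContinuousAlternatingMap.ofSubsingleton ℝ (TangentSpace IG g) (LieAlg IG G) 0 (leftMC IG g)

variable (I IG) in
/-- The left logarithmic derivative `a⁻¹ da` of a map `a` to a Lie group. -/
def leftLogDeriv (a : M → G) (x : M) : E →L[ℝ] LieAlg IG G :=
  (tderiv IG IG (fun h => (a x)⁻¹ * h) (a x)).comp (tderiv I IG a x)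

theorem plot_maurerCartan (a : W → G) (x : W) (v : W) :
    (maurerCartan IG G).plot a x ![v] = leftLogDeriv IG 𝓘(ℝ, W) a x v :=
  rfl

theorem Ad_eq_tderiv (g : G) : Ad IG g = tderiv IG IG (fun h : G => g * h * g⁻¹) 1 := rfl

theorem leftLogDeriv_const (g : G) (x : M) : leftLogDeriv IG I (fun _ => g) x = 0 := by
  rw [leftLogDeriv, tderiv_const, ContinuousLinearMap.comp_zero]

theorem leftLogDeriv_congr {a b : M → G} {x : M} (h : a =ᶠ[𝓝 x] b) :
    leftLogDeriv IG I a x = leftLogDeriv IG I b x := by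
  rw [leftLogDeriv, leftLogDeriv, tderiv_congr h, h.eq_of_nhds]

theorem leftLogDeriv_comp {a : M → G} {f : M' → M} {x : M'} (ha : MDifferentiableAt I IG a (f x))
    (hf : MDifferentiableAt I' I f x) (v : E') :
    leftLogDeriv IG I' (fun z => a (f z)) x v = leftLogDeriv IG I a (f x) (tderiv I' I f x v) := by
  simp only [leftLogDeriv, ContinuousLinearMap.comp_apply, tderiv_comp ha hf]

variable [LieGroup IG ∞ G]

theorem mdifferentiable_mul_left (g : G) : MDifferentiable IG IG (fun h : G => g * h) :=
  (contMDiff_mul_left (I := IG) (n := ∞)).mdifferentiable (by simp)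

theorem mdifferentiable_mul : MDifferentiable (IG.prod IG) IG (fun p : G × G => p.1 * p.2) :=
  (contMDiff_mul IG ∞).mdifferentiable (by simp)

theorem mdifferentiable_conj (g : G) : MDifferentiable IG IG (fun h : G => g * h * g⁻¹) :=
  ((contMDiff_const.mul contMDiff_id).mul contMDiff_const : ContMDiff IG IG ∞ _).mdifferentiable
    (by simp)

theorem _root_.MDifferentiableAt.group_mul {a b : M → G} {x : M} (ha : MDifferentiableAt I IG a x)
    (hb : MDifferentiableAt I IG b x) : MDifferentiableAt I IG (fun z => a z * b z) x :=
  MDifferentiableAt.comp x (g := fun p : G × G => p.1 * p.2) (mdifferentiable_mul _) (ha.prodMk hb)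

theorem leftLogDeriv_eq_tderiv {a : M → G} {x : M} (ha : MDifferentiableAt I IG a x) :
    leftLogDeriv IG I a x = tderiv I IG (fun z => (a x)⁻¹ * a z) x :=
  (tderiv_comp_of_eq (mdifferentiable_mul_left _ _) ha rfl).symm

omit [LieGroup IG ∞ G] in
theorem Ad_one : Ad IG (1 : G) = ContinuousLinearMap.id ℝ EG := by
  simp only [Ad_eq_tderiv, one_mul, inv_one, mul_one, tderiv_id]

theorem Ad_mul (g h : G) (v : EG) : Ad IG (g * h) v = Ad IG g (Ad IG h v) := by
  have := tderiv_comp_of_eq (I₁ := IG) (I₂ := IG) (I₃ := IG) (g := fun k : G => g * k * g⁻¹)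
    (f := fun k : G => h * k * h⁻¹) (x := 1) (y := 1)
    (mdifferentiable_conj g _) (mdifferentiable_conj h _) (by simp)
  simp only [Ad_eq_tderiv]
  rw [← ContinuousLinearMap.comp_apply, ← this]
  simp only [mul_assoc, mul_inv_rev]

/-- The product rule for `z ↦ (a x b x)⁻¹ a z b z`: freezing `b` leaves `(a x)⁻¹ a z` conjugated by
`(b x)⁻¹`, and freezing `a` leaves `(b x)⁻¹ b z`. -/
theorem leftLogDeriv_mul {a b : M → G} {x : M} (ha : MDifferentiableAt I IG a x)
    (hb : MDifferentiableAt I IG b x) (v : E) :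
    leftLogDeriv IG I (fun z => a z * b z) x v =
      Ad IG (b x)⁻¹ (leftLogDeriv IG I a x v) + leftLogDeriv IG I b x v := by
  rw [leftLogDeriv_eq_tderiv (ha.group_mul hb), leftLogDeriv_eq_tderiv ha,
    leftLogDeriv_eq_tderiv hb]
  have hp : MDifferentiable (IG.prod IG) IG (fun p : G × G => (a x * b x)⁻¹ * (p.1 * p.2)) :=
    fun p => MDifferentiableAt.comp p (mdifferentiable_mul_left _ _) (mdifferentiable_mul p)
  rw [tderiv_comp₂ (Φ := fun p : G × G => (a x * b x)⁻¹ * (p.1 * p.2)) (hp _) ha hb]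
  have ha' : MDifferentiableAt I IG (fun z => (a x)⁻¹ * a z) x :=
    MDifferentiableAt.comp x (g := fun h => (a x)⁻¹ * h) (mdifferentiable_mul_left _ _) ha
  rw [Ad_eq_tderiv, ← ContinuousLinearMap.comp_apply,
    ← tderiv_comp_of_eq (mdifferentiable_conj _ _) ha' (by simp)]
  simp only [mul_assoc, mul_inv_rev, inv_mul_cancel_left, inv_inv]

theorem leftLogDeriv_const_mul {b : M → G} {x : M} (g : G) (hb : MDifferentiableAt I IG b x) (v : E) :
    leftLogDeriv IG I (fun z => g * b z) x v = leftLogDeriv IG I b x v := by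
  rw [leftLogDeriv_mul (a := fun _ => g) mdifferentiableAt_const hb, leftLogDeriv_const]
  simp

theorem leftLogDeriv_mul_const {a : M → G} {x : M} (g : G) (ha : MDifferentiableAt I IG a x) (v : E) :
    leftLogDeriv IG I (fun z => a z * g) x v = Ad IG g⁻¹ (leftLogDeriv IG I a x v) := by
  rw [leftLogDeriv_mul (b := fun _ => g) ha mdifferentiableAt_const, leftLogDeriv_const]
  simp

theorem leftLogDeriv_id_one : leftLogDeriv IG IG (fun g : G => g) 1 =
    ContinuousLinearMap.id ℝ EG := by
  rw [leftLogDeriv_eq_tderiv (a := fun g : G => g) mdifferentiableAt_id]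
  simp only [inv_one, one_mul, tderiv_id]

section Smooth
variable [IG.Boundaryless]

theorem contDiffAt_Ad_inv {N : W → G} {w : W} (hN : ContMDiffAt 𝓘(ℝ, W) IG ∞ N w) :
    ContDiffAt ℝ ∞ (fun w => Ad IG (N w)⁻¹) w := by
  have : IsManifold IG ∞ G := ContMDiffMul.toIsManifold
  refine contDiffAt_tderiv_family (I₁ := IG) (I₂ := IG) (I₃ := IG) (y := (1 : G)) (c := (1 : G))
    (F := fun p : G × G => p.1⁻¹ * p.2 * p.1⁻¹⁻¹) ?_ (by simp) hN
  exact (contMDiff_fst.inv.mul contMDiff_snd).mul contMDiff_fst.inv.inv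

omit [IG.Boundaryless] in
theorem contDiffAt_plot_maurerCartan {N : W → G} {w : W} (hN : ContMDiffAt 𝓘(ℝ, W) IG ∞ N w) :
    ContDiffAt ℝ ∞ ((maurerCartan IG G).plot N) w := by
  have : IsManifold IG ∞ G := ContMDiffMul.toIsManifold
  -- The map `s ↦ (N z)⁻¹ N s` takes the value `1` at `s = z`, so the chart at `1` serves for all
  -- `z`, and smoothness is that of a parametric derivative evaluated on the diagonal.
  have key : ∀ᶠ z in 𝓝 w, (maurerCartan IG G).plot N z =
      ContinuousAlternatingMap.ofSubsingletonLIE (𝕜 := ℝ) (E := W) (F := EG) (0 : Fin 1)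
        (fderiv ℝ (fun s => extChartAt IG (1 : G) ((N z)⁻¹ * N s)) z) := by
    filter_upwards [(contMDiffAt_iff_contMDiffAt_nhds (by simp)).1
      (hN.of_le (m := 1) (by simp))] with z hz
    have hd := hz.mdifferentiableAt (by simp)
    have hd' : MDifferentiableAt 𝓘(ℝ, W) IG (fun s => (N z)⁻¹ * N s) z :=
      MDifferentiableAt.comp z (g := fun h => (N z)⁻¹ * h) (mdifferentiable_mul_left _ _) hd
    ext v
    have : v = ![v 0] := by ext i; fin_cases i; rfl
    rw [this, plot_maurerCartan, leftLogDeriv_eq_tderiv hd, tderiv_eq_fderiv hd', inv_mul_cancel]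
    rfl
  refine ContDiffAt.congr_of_eventuallyEq ?_ key
  refine (ContinuousAlternatingMap.ofSubsingletonLIE (𝕜 := ℝ) (E := W) (F := EG)
    (0 : Fin 1)).contDiff.contDiffAt.comp w ?_
  refine ContDiffAt.fderiv (n := ∞) (m := ∞)
    (f := fun z s => extChartAt IG (1 : G) ((N z)⁻¹ * N s)) (g := fun z => z) ?_ contDiffAt_id
    (by simp)
  rw [← contMDiffAt_iff_contDiffAt]
  have h1 : ContMDiffAt 𝓘(ℝ, W × W) IG ∞ (fun p : W × W => (N p.1)⁻¹ * N p.2) (w, w) :=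
    (ContMDiffAt.comp (w, w) (I' := 𝓘(ℝ, W)) (g := N) hN
        contDiff_fst.contMDiff.contMDiffAt).inv.mul
      (ContMDiffAt.comp (w, w) (I' := 𝓘(ℝ, W)) (g := N) hN contDiff_snd.contMDiff.contMDiffAt)
  refine ContMDiffAt.comp (w, w) (I' := IG) (g := extChartAt IG (1 : G)) ?_ h1
  simp only [inv_mul_cancel]
  exact contMDiffAt_extChartAt

theorem smoothOn_maurerCartan : (maurerCartan IG G).SmoothOn univ := by
  have : IsManifold IG ∞ G := ContMDiffMul.toIsManifold
  exact DiffForm.smoothOn_of_contDiffAt fun x y hy _ =>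
    contDiffAt_plot_maurerCartan (contMDiffAt_extChartAt_symm x hy)

end Smooth
end Lie

section
variable {E : Type*} [NormedAddCommGroup E] [NormedSpace ℝ E] {H : Type*} [TopologicalSpace H]
  {I : ModelWithCorners ℝ E H} {M : Type*} [TopologicalSpace M] [ChartedSpace H M]

theorem tderiv_extChartAt_symm [IsManifold I ∞ M] [I.Boundaryless] (x : M) :
    tderiv 𝓘(ℝ, E) I (extChartAt I x).symm (extChartAt I x x) = ContinuousLinearMap.id ℝ E := by
  have : IsManifold I 1 M := IsManifold.of_le (n := ∞) (by simp)
  refine Eq.trans ?_ (mfderivWithin_range_extChartAt_symm (I := I) (x := x))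
  rw [tderiv, I.range_eq_univ, mfderivWithin_univ]
end

/-! ### The Maurer-Cartan equation and the structure equation -/

section Lie
variable {EG : Type*} [NormedAddCommGroup EG] [NormedSpace ℝ EG]
  {HG : Type*} [TopologicalSpace HG] {IG : ModelWithCorners ℝ EG HG}
  {G : Type*} [TopologicalSpace G] [ChartedSpace HG G] [Group G] [LieGroup IG ∞ G]
  {W : Type*} [NormedAddCommGroup W] [NormedSpace ℝ W]

theorem tderiv_inv_mul_tderiv_mul (g : G) (A : EG) :
    tderiv IG IG (fun h : G => g⁻¹ * h) g (tderiv IG IG (fun h : G => g * h) 1 A) = A := by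
  rw [← ContinuousLinearMap.comp_apply, ← tderiv_comp_of_eq (mdifferentiable_mul_left _ _)
    (mdifferentiable_mul_left _ _) (mul_one g)]
  simp only [inv_mul_cancel_left, tderiv_id]
  rfl

section
variable (IG G)
theorem lieGroup_three : LieGroup IG (minSmoothness ℝ 3) G := by
  rw [minSmoothness_of_isRCLikeNormedField]; infer_instance

variable [CompleteSpace EG]

theorem lieBr_add (a b c : LieAlg IG G) :
    lieBr (G := G) IG a (b + c) = lieBr (G := G) IG a b + lieBr (G := G) IG a c :=
  have := lieGroup_three IG G
  lie_add (L := GroupLieAlgebra IG G) (M := GroupLieAlgebra IG G) a b c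

theorem add_lieBr (a b c : LieAlg IG G) :
    lieBr (G := G) IG (a + b) c = lieBr (G := G) IG a c + lieBr (G := G) IG b c :=
  have := lieGroup_three IG G
  add_lie (L := GroupLieAlgebra IG G) (M := GroupLieAlgebra IG G) a b c

theorem lieBr_skew (a b : LieAlg IG G) : -lieBr (G := G) IG b a = lieBr (G := G) IG a b :=
  have := lieGroup_three IG G
  lie_skew (L := GroupLieAlgebra IG G) a b
end

variable [IG.Boundaryless] [FiniteDimensional ℝ EG]

/-- Left-invariant fields `X A`, `X B`, read in the chart, make the form constant. In the formula
for `d` on vector fields only the term with the bracket of the fields survives, and that bracket at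
`1` defines the Lie bracket. -/
theorem extDeriv_maurerCartan_inChart_one (A B : EG) :
    extDeriv ((maurerCartan IG G).plot (extChartAt IG (1 : G)).symm) (extChartAt IG (1 : G) 1)
      ![A, B] = -lieBr (G := G) IG A B := by
  have : LieGroup IG (minSmoothness ℝ 3) G := lieGroup_three IG G
  have hman : IsManifold IG ∞ G := ContMDiffMul.toIsManifold
  have hman1 : IsManifold IG 1 G := IsManifold.of_le (n := ∞) (by simp)
  have hman2 : IsManifold IG 2 G := IsManifold.of_le (n := ∞) ENat.LEInfty.out
  have : CompleteSpace EG := FiniteDimensional.complete ℝ EG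
  set χ := extChartAt IG (1 : G) with hχ
  set X : EG → EG → EG := fun A => VectorField.mpullbackWithin 𝓘(ℝ, EG) IG χ.symm
    (mulInvariantVectorField (I := IG) (G := G) A) (range IG) with hX
  have hXd : ∀ A, DifferentiableAt ℝ (X A) (χ 1) := fun A => by
    have := MDifferentiableWithinAt.differentiableWithinAt_mpullbackWithin_vectorField (s := univ)
      (mdifferentiableAt_mulInvariantVectorField (I := IG) (G := G) A (g := 1)).mdifferentiableWithinAt
    rw [preimage_univ, univ_inter] at this
    exact this.differentiableAt (by rw [IG.range_eq_univ]; exact Filter.univ_mem)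
  have hXv : ∀ A, ∀ y ∈ χ.target, tderiv 𝓘(ℝ, EG) IG χ.symm y (X A y) =
      tderiv IG IG (fun h : G => χ.symm y * h) 1 A := fun A y hy => by
    have hi := isInvertible_mfderivWithin_extChartAt_symm (I := IG) (x := (1 : G)) hy
    refine Eq.trans ?_ (hi.self_apply_inverse
      (mulInvariantVectorField (I := IG) (G := G) A (χ.symm y)))
    rw [tderiv, ← mfderivWithin_univ, ← IG.range_eq_univ]
    rfl
  have hω : ∀ A, ∀ y ∈ χ.target, (maurerCartan IG G).plot χ.symm y ![X A y] = A := fun A y hy => by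
    rw [plot_maurerCartan, leftLogDeriv, ContinuousLinearMap.comp_apply, hXv A y hy,
      tderiv_inv_mul_tderiv_mul]
  have ht : χ.target ∈ 𝓝 (χ 1) := extChartAt_target_mem_nhds (I := IG) (1 : G)
  have hX1 : ∀ A, X A (χ 1) = A := fun A => by
    have := hXv A (χ 1) (mem_extChartAt_target (I := IG) (1 : G))
    rw [tderiv_extChartAt_symm, extChartAt_to_inv] at this
    simp only [one_mul, tderiv_id] at this
    exact this
  have hd : DifferentiableAt ℝ ((maurerCartan IG G).plot χ.symm) (χ 1) :=
    (contDiffAt_plot_maurerCartan (contMDiffAt_extChartAt_symm 1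
      (mem_extChartAt_target (I := IG) (1 : G)))).differentiableAt (by simp)
  have key := extDeriv_apply_vectorField (V := ![X A, X B]) hd
    (by intro i; fin_cases i <;> simp [hXd])
  have e : (fun i => (![X A, X B] : Fin 2 → EG → EG) i (χ 1)) = ![A, B] := by
    ext i; fin_cases i <;> simp [hX1]
  rw [e] at key
  rw [key, Fin.sum_univ_two]
  have h0 : ∀ y, (0 : Fin 2).removeNth (fun i => (![X A, X B] : Fin 2 → EG → EG) i y) = ![X B y] := by
    intro y; ext i; fin_cases i; rfl
  have h1 : ∀ y, (1 : Fin 2).removeNth (fun i => (![X A, X B] : Fin 2 → EG → EG) i y) = ![X A y] := by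
    intro y; ext i; fin_cases i; rfl
  simp only [h0, h1]
  have c : ∀ A, (fun y => (maurerCartan IG G).plot χ.symm y ![X A y]) =ᶠ[𝓝 (χ 1)]
      fun _ => A := fun A => by
    filter_upwards [ht] with y hy using hω A y hy
  rw [(c A).fderiv_eq, (c B).fderiv_eq]
  -- The manifold bracket at `1` is by definition the chart bracket transported by the inverse of
  -- the chart's derivative, which is the identity at the centre of the chart.
  have hb : VectorField.lieBracket ℝ (X A) (X B) (χ 1) = lieBr (G := G) IG A B := by
    have h2 : lieBr (G := G) IG A B = (tderiv IG 𝓘(ℝ, EG) χ 1).inverse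
        (VectorField.lieBracketWithin ℝ (X A) (X B) (χ.symm ⁻¹' univ ∩ range IG) (χ 1)) := rfl
    have h3 : tderiv IG 𝓘(ℝ, EG) χ 1 = ContinuousLinearMap.id ℝ EG := mfderiv_extChartAt_self
    rw [h2, h3, preimage_univ, univ_inter, IG.range_eq_univ, VectorField.lieBracketWithin_univ,
      ContinuousLinearMap.inverse_id]
    rfl
  have hω1 : ∀ u : EG, (maurerCartan IG G).plot χ.symm (χ 1) ![u] = u := fun u => by
    simpa [hX1] using hω u (χ 1) (mem_extChartAt_target (I := IG) (1 : G))
  simp [hb]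
  exact hω1 _

theorem d_maurerCartan_of_eq_one {g : G} (hg : g = 1) (A B : EG) :
    (maurerCartan IG G).d g ![A, B] = -lieBr (G := G) IG A B := by
  subst hg
  have hman : IsManifold IG ∞ G := ContMDiffMul.toIsManifold
  have : IsManifold IG 1 G := IsManifold.of_le (n := ∞) (by simp)
  rw [← extDeriv_maurerCartan_inChart_one]
  have h3 : tderiv IG 𝓘(ℝ, EG) (extChartAt IG (1 : G)) 1 = ContinuousLinearMap.id ℝ EG :=
    mfderiv_extChartAt_self
  have h4 : (maurerCartan IG G).d 1 ![A, B] =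
      extDeriv ((maurerCartan IG G).plot (extChartAt IG (1 : G)).symm) (extChartAt IG (1 : G) 1)
        (fun i => tderiv IG 𝓘(ℝ, EG) (extChartAt IG (1 : G)) 1 ((![A, B] : Fin 2 → EG) i)) := rfl
  rw [h4, h3]
  rfl

/-- The Maurer-Cartan equation. -/
theorem extDeriv_plot_maurerCartan {N : W → G} {w : W} (hN : ContMDiffAt 𝓘(ℝ, W) IG ∞ N w)
    (u v : W) :
    extDeriv ((maurerCartan IG G).plot N) w ![u, v] =
      -lieBr (G := G) IG (leftLogDeriv IG 𝓘(ℝ, W) N w u) (leftLogDeriv IG 𝓘(ℝ, W) N w v) := by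
  have hman : IsManifold IG ∞ G := ContMDiffMul.toIsManifold
  have hd := (contMDiffAt_iff_contMDiffAt_nhds (by simp)).1 (hN.of_le (m := 1) (by simp))
  -- Left invariance: translating `N` to pass through `1` at `w` leaves the pulled-back form
  -- unchanged near `w`, so the equation at `1` suffices.
  set N' : W → G := fun z => (N w)⁻¹ * N z with hN'
  have e : (maurerCartan IG G).plot N =ᶠ[𝓝 w] (maurerCartan IG G).plot N' := by
    filter_upwards [hd] with z hz
    ext v
    have : v = ![v 0] := by ext i; fin_cases i; rfl
    rw [this, plot_maurerCartan, plot_maurerCartan, hN',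
      leftLogDeriv_const_mul _ (hz.mdifferentiableAt (by simp))]
  have hN'd : ContMDiffAt 𝓘(ℝ, W) IG ∞ N' w := contMDiffAt_const.mul hN
  have hmd := hN.mdifferentiableAt (by simp : (∞ : WithTop ℕ∞) ≠ 0)
  rw [e.extDeriv_eq, DiffForm.extDeriv_plot smoothOn_maurerCartan isOpen_univ hN'd (mem_univ _),
    leftLogDeriv_eq_tderiv hmd, ← d_maurerCartan_of_eq_one (g := N' w) (by simp [hN'])]
  refine congrArg ((maurerCartan IG G).d (N' w)) ?_
  ext i
  fin_cases i <;> rfl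

omit [FiniteDimensional ℝ EG] in
theorem leftLogDeriv_extChartAt_one_symm :
    leftLogDeriv IG 𝓘(ℝ, EG) (extChartAt IG (1 : G)).symm (extChartAt IG (1 : G) 1) =
      ContinuousLinearMap.id ℝ EG := by
  have hman : IsManifold IG ∞ G := ContMDiffMul.toIsManifold
  have hs := (contMDiffAt_extChartAt_symm (1 : G)
    (mem_extChartAt_target (I := IG) (1 : G))).mdifferentiableAt (by simp)
  ext v
  refine (leftLogDeriv_comp (a := fun g : G => g) mdifferentiableAt_id hs v).trans ?_
  rw [extChartAt_to_inv, leftLogDeriv_id_one, tderiv_extChartAt_symm]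
  rfl

theorem extDeriv_clm_comp {V V' : Type*} [NormedAddCommGroup V] [NormedSpace ℝ V]
    [NormedAddCommGroup V'] [NormedSpace ℝ V'] (L : V →L[ℝ] V') {α : W → W [⋀^Fin 1]→L[ℝ] V} {w : W}
    (h : DifferentiableAt ℝ α w) (u v : W) :
    extDeriv (fun x => L.compContinuousAlternatingMap (α x)) w ![u, v] =
      L (extDeriv α w ![u, v]) := by
  have h' : DifferentiableAt ℝ (fun x => L.compContinuousAlternatingMap (α x)) w :=
    (ContinuousLinearMap.compContinuousAlternatingMapCLM ℝ W V V' (Fin 1) L).differentiableAt.comp w h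
  rw [extDeriv_one_apply h', extDeriv_one_apply h, map_sub]
  have : ∀ v : W, fderiv ℝ (fun x => L.compContinuousAlternatingMap (α x) ![v]) w =
      L.comp (fderiv ℝ (fun x => α x ![v]) w) := fun v =>
    (L.hasFDerivAt.comp w (h.alternating_apply_const ![v]).hasFDerivAt).fderiv
  rw [this, this]
  rfl

/-- The pullback of the Maurer-Cartan form along `g N g⁻¹` is `Ad g` applied to its pullback along
`N`. Taking `d` of both sides, with `N` the inverse chart at `1`, turns the Maurer-Cartan equation
into the claim. -/
theorem Ad_lieBr (g : G) (A B : EG) :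
    Ad IG g (lieBr (G := G) IG A B) = lieBr (G := G) IG (Ad IG g A) (Ad IG g B) := by
  have hman : IsManifold IG ∞ G := ContMDiffMul.toIsManifold
  have hs := contMDiffAt_extChartAt_symm (1 : G) (mem_extChartAt_target (I := IG) (1 : G))
  set N := (extChartAt IG (1 : G)).symm
  set y := extChartAt IG (1 : G) 1
  have hd := (contMDiffAt_iff_contMDiffAt_nhds (by simp)).1 (hs.of_le (m := 1) (by simp))
  have hAd : ∀ z, ContMDiffAt 𝓘(ℝ, EG) IG 1 N z → ∀ v,
      leftLogDeriv IG 𝓘(ℝ, EG) (fun z => g * N z * g⁻¹) z v =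
        Ad IG g (leftLogDeriv IG 𝓘(ℝ, EG) N z v) := fun z hz v => by
    have hz := hz.mdifferentiableAt (by simp)
    rw [leftLogDeriv_mul_const (a := fun z => g * N z) _ (mdifferentiableAt_const.group_mul hz),
      leftLogDeriv_const_mul _ hz, inv_inv]
  have e : (maurerCartan IG G).plot (fun z => g * N z * g⁻¹) =ᶠ[𝓝 y]
      fun z => (Ad IG g).compContinuousAlternatingMap ((maurerCartan IG G).plot N z) := by
    filter_upwards [hd] with z hz
    ext v
    have : v = ![v 0] := by ext i; fin_cases i; rfl
    rw [this, plot_maurerCartan, hAd z hz]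
    rfl
  have h1 := extDeriv_plot_maurerCartan (N := fun z => g * N z * g⁻¹) (w := y)
    ((contMDiffAt_const.mul hs).mul contMDiffAt_const) A B
  rw [e.extDeriv_eq, extDeriv_clm_comp _ ((contDiffAt_plot_maurerCartan hs).differentiableAt
    (by simp)), extDeriv_plot_maurerCartan hs, hAd y hd.self_of_nhds, hAd y hd.self_of_nhds,
    leftLogDeriv_extChartAt_one_symm, map_neg, neg_inj] at h1
  exact h1

/-- This is a mixed component of the Maurer-Cartan equation. For `F (s, z) = S s * N z`, with `S`
the inverse chart at `1`, the logarithmic derivative is `Ad (N z)⁻¹ (S⁻¹ dS) + N⁻¹ dN`; evaluating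
`d` on `(A, 0)` and `(0, v)` isolates the derivative of `Ad (N z)⁻¹ A`. -/
theorem fderiv_Ad_inv_apply {N : W → G} {w : W} (hN : ContMDiffAt 𝓘(ℝ, W) IG ∞ N w) (A : EG)
    (v : W) : fderiv ℝ (fun z => Ad IG (N z)⁻¹ A) w v =
      -lieBr (G := G) IG (leftLogDeriv IG 𝓘(ℝ, W) N w v) (Ad IG (N w)⁻¹ A) := by
  have hman : IsManifold IG ∞ G := ContMDiffMul.toIsManifold
  have : CompleteSpace EG := FiniteDimensional.complete ℝ EG
  have hs := contMDiffAt_extChartAt_symm (1 : G) (mem_extChartAt_target (I := IG) (1 : G))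
  have hNs := leftLogDeriv_extChartAt_one_symm (IG := IG) (G := G)
  set S := (extChartAt IG (1 : G)).symm
  set y := extChartAt IG (1 : G) 1
  set F : EG × W → G := fun p => S p.1 * N p.2 with hF
  have hF' : ContMDiffAt 𝓘(ℝ, EG × W) IG ∞ F (y, w) :=
    (ContMDiffAt.comp (y, w) (I' := 𝓘(ℝ, EG)) (g := S) hs contDiff_fst.contMDiff.contMDiffAt).mul
      (ContMDiffAt.comp (y, w) (I' := 𝓘(ℝ, W)) (g := N) hN contDiff_snd.contMDiff.contMDiffAt)
  have hdN := (contMDiffAt_iff_contMDiffAt_nhds (by simp)).1 (hN.of_le (m := 1) (by simp))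
  have hdS := (contMDiffAt_iff_contMDiffAt_nhds (by simp)).1 (hs.of_le (m := 1) (by simp))
  have hform : ∀ᶠ p in 𝓝 (y, w), ∀ q : EG × W, (maurerCartan IG G).plot F p ![q] =
      Ad IG (N p.2)⁻¹ (leftLogDeriv IG 𝓘(ℝ, EG) S p.1 q.1) +
        leftLogDeriv IG 𝓘(ℝ, W) N p.2 q.2 := by
    filter_upwards [continuousAt_fst.eventually hdS, continuousAt_snd.eventually hdN]
      with p hp1 hp2 q
    have hp1 := hp1.mdifferentiableAt (by simp)
    have hp2 := hp2.mdifferentiableAt (by simp)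
    have hfst : MDifferentiableAt 𝓘(ℝ, EG × W) 𝓘(ℝ, EG) Prod.fst p :=
      differentiableAt_fst.mdifferentiableAt
    have hsnd : MDifferentiableAt 𝓘(ℝ, EG × W) 𝓘(ℝ, W) Prod.snd p :=
      differentiableAt_snd.mdifferentiableAt
    have t1 : tderiv 𝓘(ℝ, EG × W) 𝓘(ℝ, EG) Prod.fst p = ContinuousLinearMap.fst ℝ EG W :=
      mfderiv_eq_fderiv.trans fderiv_fst
    have t2 : tderiv 𝓘(ℝ, EG × W) 𝓘(ℝ, W) Prod.snd p = ContinuousLinearMap.snd ℝ EG W :=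
      mfderiv_eq_fderiv.trans fderiv_snd
    rw [plot_maurerCartan, leftLogDeriv_mul (a := fun p : EG × W => S p.1)
      (b := fun p : EG × W => N p.2) (hp1.comp p hfst) (hp2.comp p hsnd),
      leftLogDeriv_comp hp1 hfst, leftLogDeriv_comp hp2 hsnd, t1, t2]
    rfl
  have hdiff : DifferentiableAt ℝ ((maurerCartan IG G).plot F) (y, w) :=
    (contDiffAt_plot_maurerCartan hF').differentiableAt (by simp)
  have key := extDeriv_plot_maurerCartan hF' (A, 0) (0, v)
  rw [extDeriv_one_apply hdiff, ← plot_maurerCartan, ← plot_maurerCartan,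
    hform.self_of_nhds, hform.self_of_nhds, hNs] at key
  -- On `(0, v)` the form does not involve the first coordinate, so its derivative along `(A, 0)`
  -- vanishes.
  have f1 : fderiv ℝ (fun p => (maurerCartan IG G).plot F p ![((0 : EG), v)]) (y, w) (A, 0) =
      0 := by
    have e : (fun p => (maurerCartan IG G).plot F p ![((0 : EG), v)]) =ᶠ[𝓝 (y, w)]
        fun p => (maurerCartan IG G).plot N p.2 ![v] := by
      filter_upwards [hform] with p hp
      simp [hp, plot_maurerCartan]
    have hdN' : DifferentiableAt ℝ (fun z => (maurerCartan IG G).plot N z ![v]) w :=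
      ((contDiffAt_plot_maurerCartan hN).differentiableAt (by simp)).alternating_apply_const _
    have h2 := HasFDerivAt.comp (f := Prod.snd) (y, w) hdN'.hasFDerivAt hasFDerivAt_snd
    rw [e.fderiv_eq]
    refine (congrArg (fun L => L (A, 0)) h2.fderiv).trans ?_
    simp
  -- A derivative along `(0, v)` only sees the slice through `y`, where the logarithmic derivative
  -- of `S` is the identity.
  have f2 : fderiv ℝ (fun p => (maurerCartan IG G).plot F p ![(A, (0 : W))]) (y, w) (0, v) =
      fderiv ℝ (fun z => Ad IG (N z)⁻¹ A) w v := by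
    have hι : HasFDerivAt (fun z : W => (y, z)) (ContinuousLinearMap.inr ℝ EG W) w :=
      hasFDerivAt_prodMk_right y w
    have e : (fun z => Ad IG (N z)⁻¹ A) =ᶠ[𝓝 w]
        fun z => (maurerCartan IG G).plot F (y, z) ![(A, (0 : W))] := by
      filter_upwards [hι.continuousAt.eventually hform] with z hz
      simp [hz, hNs]
    have h2 := HasFDerivAt.comp w
      (hdiff.alternating_apply_const ![(A, (0 : W))]).hasFDerivAt hι
    rw [e.fderiv_eq]
    exact (congrArg (fun L => L v) h2.fderiv).symm
  rw [f1, f2] at key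
  simp only [zero_sub, neg_inj, ContinuousLinearMap.id_apply, map_zero, add_zero, zero_add] at key
  rw [key, lieBr_skew]

/-- Differentiating `Ad (N⁻¹)` produces brackets of `N⁻¹ dN` with `Ad (N⁻¹) ν`, which cancel the
cross terms of `[ψ, ψ]`. The Maurer-Cartan equation cancels the bracket of `N⁻¹ dN` with itself, and
`Ad_lieBr` handles what remains. -/
theorem structure_equation [FiniteDimensional ℝ W] {N : W → G} {w : W}
    (hN : ContMDiffAt 𝓘(ℝ, W) IG ∞ N w)
    {ν ψ : W → W [⋀^Fin 1]→L[ℝ] EG} (hν : ContDiffAt ℝ ∞ ν w)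
    (hψ : ψ =ᶠ[𝓝 w] fun z => (Ad IG (N z)⁻¹).compContinuousAlternatingMap (ν z) +
      (maurerCartan IG G).plot N z) (u v : W) :
    extDeriv ψ w ![u, v] + lieBr (G := G) IG (ψ w ![u]) (ψ w ![v]) =
      Ad IG (N w)⁻¹ (extDeriv ν w ![u, v] + lieBr (G := G) IG (ν w ![u]) (ν w ![v])) := by
  have : CompleteSpace EG := FiniteDimensional.complete ℝ EG
  have hAd : DifferentiableAt ℝ (fun z => Ad IG (N z)⁻¹) w :=
    (contDiffAt_Ad_inv hN).differentiableAt (by simp)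
  have hMC : DifferentiableAt ℝ ((maurerCartan IG G).plot N) w :=
    (contDiffAt_plot_maurerCartan hN).differentiableAt (by simp)
  have hψd : DifferentiableAt ℝ ψ w := by
    exact DifferentiableAt.congr_of_eventuallyEq (DifferentiableAt.add
      ((hν.compContinuousAlternatingMap (contDiffAt_Ad_inv hN)).differentiableAt (by simp)) hMC) hψ
  have hν : DifferentiableAt ℝ ν w := hν.differentiableAt (by simp)
  have hA : ∀ (B : EG) (u : W), fderiv ℝ (fun z => Ad IG (N z)⁻¹) w u B =
      -lieBr (G := G) IG (leftLogDeriv IG 𝓘(ℝ, W) N w u) (Ad IG (N w)⁻¹ B) := fun B u => by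
    rw [← fderiv_Ad_inv_apply hN, fderiv_clm_apply hAd (differentiableAt_const B)]
    simp
  have hD : ∀ u v : W, fderiv ℝ (fun z => ψ z ![v]) w u =
      -lieBr (G := G) IG (leftLogDeriv IG 𝓘(ℝ, W) N w u) (Ad IG (N w)⁻¹ (ν w ![v])) +
      Ad IG (N w)⁻¹ (fderiv ℝ (fun z => ν z ![v]) w u) +
      fderiv ℝ (fun z => (maurerCartan IG G).plot N z ![v]) w u := fun u v => by
    have e : (fun z => ψ z ![v]) =ᶠ[𝓝 w] fun z => Ad IG (N z)⁻¹ (ν z ![v]) +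
        (maurerCartan IG G).plot N z ![v] := by
      filter_upwards [hψ] with z hz
      rw [hz]; rfl
    have hνv := hν.alternating_apply_const ![v]
    rw [e.fderiv_eq, fderiv_fun_add (hAd.clm_apply hνv) (hMC.alternating_apply_const ![v]),
      fderiv_clm_apply hAd hνv, ← hA]
    simp [add_comm]
  have hm := extDeriv_plot_maurerCartan hN u v
  rw [extDeriv_one_apply hMC] at hm
  have hw : ∀ u, ψ w ![u] = Ad IG (N w)⁻¹ (ν w ![u]) + leftLogDeriv IG 𝓘(ℝ, W) N w u := fun u => by
    rw [hψ.eq_of_nhds]; rfl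
  rw [extDeriv_one_apply hψd, extDeriv_one_apply hν, hD, hD, hw, hw, map_add, map_sub, Ad_lieBr,
    lieBr_add, add_lieBr, add_lieBr,
    ← lieBr_skew IG G (Ad IG (N w)⁻¹ (ν w ![u])) (leftLogDeriv IG 𝓘(ℝ, W) N w v)]
  rw [sub_eq_iff_eq_add] at hm
  rw [hm]
  abel
end Lie

/-! ### Pointwise evaluation of forms and the local curvature -/

section Eval
variable {E : Type*} [NormedAddCommGroup E] [NormedSpace ℝ E]
  {H : Type*} [TopologicalSpace H] {I : ModelWithCorners ℝ E H}
  {M : Type*} [TopologicalSpace M] [ChartedSpace H M]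
  {E' : Type*} [NormedAddCommGroup E'] [NormedSpace ℝ E']
  {H' : Type*} [TopologicalSpace H'] {I' : ModelWithCorners ℝ E' H'}
  {M' : Type*} [TopologicalSpace M'] [ChartedSpace H' M']
  {W : Type*} [NormedAddCommGroup W] [NormedSpace ℝ W]
  {V : Type*} [NormedAddCommGroup V] [NormedSpace ℝ V] {k : ℕ}

/-- The value of a form at a point, as an alternating map on the model space. -/
def DiffForm.eval (η : DiffForm I M k V) (x : M) : E [⋀^Fin k]→L[ℝ] V := η x

theorem DiffForm.ext_eval {η η' : DiffForm I M k V} {x : M} (h : η.eval x = η'.eval x) :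
    η x = η' x := h

theorem vec_one_eta {E : Type*} (v : Fin 1 → E) : v = ![v 0] := by
  ext i; fin_cases i; rfl

theorem vec_two_eta {E : Type*} (v : Fin 2 → E) : v = ![v 0, v 1] := by
  ext i; fin_cases i <;> rfl

theorem DiffForm.eval_pullback (f : M' → M) (η : DiffForm I M k V) (x : M') (v : Fin k → E') :
    (DiffForm.pullback (I' := I') f η).eval x v = η.eval (f x) (fun i => tderiv I' I f x (v i)) :=
  rfl

theorem DiffForm.eval_pullback_one (f : M' → M) (η : DiffForm I M 1 V) (x : M') (v : E') :
    (DiffForm.pullback (I' := I') f η).eval x ![v] = η.eval (f x) ![tderiv I' I f x v] := by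
  rw [DiffForm.eval_pullback]; congr 1; ext i; fin_cases i; rfl

theorem DiffForm.eval_pullback_two (f : M' → M) (η : DiffForm I M 2 V) (x : M') (u v : E') :
    (DiffForm.pullback (I' := I') f η).eval x ![u, v] =
      η.eval (f x) ![tderiv I' I f x u, tderiv I' I f x v] := by
  rw [DiffForm.eval_pullback]; congr 1; ext i; fin_cases i <;> rfl

theorem DiffForm.plot_apply (N : W → M) (η : DiffForm I M k V) (x : W) (v : Fin k → W) :
    η.plot N x v = η.eval (N x) (fun i => tderiv 𝓘(ℝ, W) I N x (v i)) := rfl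

theorem DiffForm.plot_apply_one (N : W → M) (η : DiffForm I M 1 V) (x : W) (v : W) :
    η.plot N x ![v] = η.eval (N x) ![tderiv 𝓘(ℝ, W) I N x v] :=
  DiffForm.eval_pullback_one N η x v

theorem DiffForm.plot_apply_two (N : W → M) (η : DiffForm I M 2 V) (x : W) (u v : W) :
    η.plot N x ![u, v] = η.eval (N x) ![tderiv 𝓘(ℝ, W) I N x u, tderiv 𝓘(ℝ, W) I N x v] :=
  DiffForm.eval_pullback_two N η x u v

variable {EG : Type*} [NormedAddCommGroup EG] [NormedSpace ℝ EG] [CompleteSpace EG]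
  {HG : Type*} [TopologicalSpace HG] {IG : ModelWithCorners ℝ EG HG}
  {G : Type*} [TopologicalSpace G] [ChartedSpace HG G] [Group G] [LieGroup IG ∞ G]

/-- Skew-symmetry makes the two terms of the wedge equal, which absorbs the factor `1 / 2`. -/
theorem localCurvature_eq (η : DiffForm I M 1 (LieAlg IG G)) (x : M) (X Y : E) :
    localCurvature (IG := IG) (G := G) η x X Y =
      η.d.eval x ![X, Y] + lieBr (G := G) IG (η.eval x ![X]) (η.eval x ![Y]) := by
  have h : ∀ a b : EG, lieBr (G := G) IG a b - lieBr (G := G) IG b a =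
      (2 : ℝ) • lieBr (G := G) IG a b := fun a b => by
    rw [sub_eq_add_neg, lieBr_skew, two_smul]
  refine congrArg (η.d.eval x ![X, Y] + ·) ?_
  refine (congrArg ((1 / 2 : ℝ) • ·) (h (η.eval x ![X]) (η.eval x ![Y]))).trans ?_
  simp only [smul_smul]
  norm_num

end Eval

/-! ### Infinitesimal crossed modules -/

section CrossedModules
variable {EG : Type*} [NormedAddCommGroup EG] [NormedSpace ℝ EG]
  {HG : Type*} [TopologicalSpace HG] {IG : ModelWithCorners ℝ EG HG}
  {G : Type*} [TopologicalSpace G] [ChartedSpace HG G] [Group G]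
  {EK : Type*} [NormedAddCommGroup EK] [NormedSpace ℝ EK]
  {HK : Type*} [TopologicalSpace HK] {IK : ModelWithCorners ℝ EK HK}
  {K : Type*} [TopologicalSpace K] [ChartedSpace HK K] [Group K]
  (𝒢 : LieCrossedModule IG G IK K)
  {W : Type*} [NormedAddCommGroup W] [NormedSpace ℝ W]

theorem LieCrossedModule.dAct_eq (g : G) :
    𝒢.dAct g = tderiv IK IK (fun e : K => 𝒢.act g e) 1 := rfl

theorem LieCrossedModule.mdifferentiable_act (g : G) :
    MDifferentiable IK IK (fun e : K => 𝒢.act g e) :=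
  (𝒢.contMDiff_act.comp (contMDiff_const.prodMk contMDiff_id)).mdifferentiable (by simp)

theorem LieCrossedModule.dAct_one : 𝒢.dAct 1 = ContinuousLinearMap.id ℝ EK := by
  simp only [LieCrossedModule.dAct_eq, map_one, MulAut.one_apply, tderiv_id]

theorem LieCrossedModule.dAct_mul (g h : G) (x : EK) :
    𝒢.dAct (g * h) x = 𝒢.dAct g (𝒢.dAct h x) := by
  simp only [LieCrossedModule.dAct_eq]
  rw [← ContinuousLinearMap.comp_apply, ← tderiv_comp_of_eq (𝒢.mdifferentiable_act g _)
    (𝒢.mdifferentiable_act h _) (map_one _)]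
  simp only [map_mul, MulAut.mul_apply]

/-- Differentiate `∂(g ▷ e) = g ∂(e) g⁻¹` at `e = 1`. -/
theorem LieCrossedModule.dBd_dAct [LieGroup IG ∞ G] (g : G) (x : EK) :
    𝒢.dBd (𝒢.dAct g x) = Ad IG g (𝒢.dBd x) := by
  have hb : MDifferentiable IK IG 𝒢.bd := 𝒢.contMDiff_bd.mdifferentiable (by simp)
  have h1 := tderiv_comp_of_eq (hb 1) (𝒢.mdifferentiable_act g 1) (map_one _)
  have h2 := tderiv_comp_of_eq (mdifferentiable_conj (IG := IG) g 1) (hb 1) (map_one _)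
  simp only [𝒢.bd_act] at h1
  exact congrArg (fun L : EK →L[ℝ] EG => L x) (h1.symm.trans h2)

theorem LieCrossedModule.contDiffAt_dAct_inv [LieGroup IG ∞ G] [IK.Boundaryless]
    [IsManifold IK ∞ K] {N : W → G} {w : W} (hN : ContMDiffAt 𝓘(ℝ, W) IG ∞ N w) :
    ContDiffAt ℝ ∞ (fun w => 𝒢.dAct (N w)⁻¹) w :=
  contDiffAt_tderiv_family (I₁ := IG) (I₂ := IK) (I₃ := IK) (y := (1 : K)) (c := (1 : K))
    (F := fun p : G × K => 𝒢.act p.1⁻¹ p.2)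
    (𝒢.contMDiff_act.comp (contMDiff_fst.inv.prodMk contMDiff_snd)) (by simp) hN

end CrossedModules

/-! ### Fibre coordinates on a principal bundle -/

section Bundles

variable {EM : Type*} [NormedAddCommGroup EM] [NormedSpace ℝ EM]
  {HM : Type*} [TopologicalSpace HM] {IM : ModelWithCorners ℝ EM HM}
  {M : Type*} [TopologicalSpace M] [ChartedSpace HM M]
  {EP : Type*} [NormedAddCommGroup EP] [NormedSpace ℝ EP]
  {HP : Type*} [TopologicalSpace HP] {IP : ModelWithCorners ℝ EP HP}
  {P : Type*} [TopologicalSpace P] [ChartedSpace HP P]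
  {EG : Type*} [NormedAddCommGroup EG] [NormedSpace ℝ EG]
  {HG : Type*} [TopologicalSpace HG] {IG : ModelWithCorners ℝ EG HG}
  {G : Type*} [TopologicalSpace G] [ChartedSpace HG G] [Group G]
  (B : PrincipalBundle IM M IP P IG G)

namespace PrincipalBundle

theorem mdifferentiable_proj : MDifferentiable IP IM B.proj :=
  B.contMDiff_proj.mdifferentiable (by simp)

theorem mdifferentiable_act : MDifferentiable (IP.prod IG) IP (fun q : P × G => B.act q.1 q.2) :=
  B.contMDiff_act.mdifferentiable (by simp)

theorem mdifferentiable_act_right (g : G) : MDifferentiable IP IP (fun p => B.act p g) :=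
  (B.contMDiff_act.comp (contMDiff_id.prodMk contMDiff_const)).mdifferentiable (by simp)

theorem mdifferentiable_orbit (p : P) : MDifferentiable IG IP (fun g => B.act p g) :=
  (B.contMDiff_act.comp (contMDiff_const.prodMk contMDiff_id)).mdifferentiable (by simp)

/-- The fundamental vector fields at `p`, as a linear map of model spaces. -/
def fundVec (p : P) : EG →L[ℝ] EP := tderiv IG IP (fun g => B.act p g) 1

theorem act_left_injective (p : P) : Function.Injective (B.act p) := fun g h hgh => by
  obtain ⟨U, Φ, -, hx, hs, -, -, -, -, ha⟩ := B.exists_triv (B.proj p)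
  have hp : p ∈ Φ.source := hs ▸ hx
  have := congrArg Φ hgh
  rw [ha p hp, ha p hp] at this
  exact mul_left_cancel (congrArg Prod.snd this)

theorem exists_act_eq {p q : P} (h : B.proj p = B.proj q) : ∃ g, B.act p g = q := by
  obtain ⟨U, Φ, -, hx, hs, -, -, -, hpr, ha⟩ := B.exists_triv (B.proj p)
  have hp : p ∈ Φ.source := hs ▸ hx
  have hq : q ∈ Φ.source := hs ▸ (h ▸ hx : B.proj q ∈ U)
  refine ⟨(Φ p).2⁻¹ * (Φ q).2, Φ.injOn ?_ hq ?_⟩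
  · rw [hs, mem_preimage, B.proj_act]; exact hx
  · rw [ha p hp, mul_inv_cancel_left, hpr p hp, h, ← hpr q hq]

open Classical in
/-- The group element `g` with `f (π p) g = p`: the coordinate of `p` in the fibre direction with
respect to the section `f`. -/
def coord (f : M → P) (p : P) : G :=
  if h : ∃ g, B.act (f (B.proj p)) g = p then h.choose else 1

variable {B} {f : M → P} {U : Set M}

theorem act_coord (hf : ∀ x ∈ U, B.proj (f x) = x) {p : P} (hp : B.proj p ∈ U) :
    B.act (f (B.proj p)) (B.coord f p) = p := by
  have h : ∃ g, B.act (f (B.proj p)) g = p := B.exists_act_eq (hf _ hp)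
  rw [coord, dif_pos h]
  exact h.choose_spec

theorem coord_act (hf : ∀ x ∈ U, B.proj (f x) = x) {p : P} (hp : B.proj p ∈ U) (g : G) :
    B.coord f (B.act p g) = B.coord f p * g := by
  apply B.act_left_injective (f (B.proj p))
  rw [B.act_mul, act_coord hf hp]
  have := act_coord hf (p := B.act p g) (by rwa [B.proj_act])
  rwa [B.proj_act] at this

theorem coord_section (hf : ∀ x ∈ U, B.proj (f x) = x) {x : M} (hx : x ∈ U) :
    B.coord f (f x) = 1 := by
  apply B.act_left_injective (f x)
  have := act_coord hf (p := f x) (by rwa [hf x hx])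
  rw [hf x hx] at this
  rw [this, B.act_one]

/-- The coordinate is defined by choice, but freeness of the action determines it over `U`. In a
trivialisation `Φ` it is `(Φ (f (π q))).2⁻¹ * (Φ q).2`, which is visibly smooth. -/
theorem contMDiffAt_coord [LieGroup IG ∞ G] (hU : IsOpen U) (hf : ∀ x ∈ U, B.proj (f x) = x)
    (hfs : ContMDiffOn IM IP ∞ f U) {p : P} (hp : B.proj p ∈ U) :
    ContMDiffAt IP IG ∞ (B.coord f) p := by
  obtain ⟨V, Φ, hV, hx, hs, -, hΦ, -, hpr, ha⟩ := B.exists_triv (B.proj p)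
  have hopen : IsOpen (B.proj ⁻¹' (U ∩ V)) := (hU.inter hV).preimage B.contMDiff_proj.continuous
  have e : B.coord f =ᶠ[𝓝 p] fun q => (Φ (f (B.proj q))).2⁻¹ * (Φ q).2 := by
    filter_upwards [hopen.mem_nhds ⟨hp, hx⟩] with q hq
    have h1 : f (B.proj q) ∈ Φ.source := by
      rw [hs, mem_preimage, hf _ hq.1]; exact hq.2
    have h2 := congrArg Prod.snd (ha _ h1 (B.coord f q))
    rw [act_coord hf hq.1] at h2
    rw [h2, inv_mul_cancel_left]
  refine ContMDiffAt.congr_of_eventuallyEq ?_ e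
  have hps : p ∈ Φ.source := hs ▸ hx
  have hfp : f (B.proj p) ∈ Φ.source := by rw [hs, mem_preimage, hf _ hp]; exact hx
  have h1 : ContMDiffAt IP IG ∞ (fun q => (Φ q).2) p :=
    (hΦ.contMDiffAt (Φ.open_source.mem_nhds hps)).snd
  have h2 : ContMDiffAt IP IG ∞ (fun q => (Φ q).2) (f (B.proj p)) :=
    (hΦ.contMDiffAt (Φ.open_source.mem_nhds hfp)).snd
  have h3 : ContMDiffAt IP IP ∞ (fun q => f (B.proj q)) p :=
    ContMDiffAt.comp p (hfs.contMDiffAt (hU.mem_nhds hp)) B.contMDiff_proj.contMDiffAt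
  exact (ContMDiffAt.comp p (g := fun q => (Φ q).2) h2 h3).inv.mul h1

theorem tderiv_proj_act (g : G) (p : P) (X : EP) :
    tderiv IP IM B.proj (B.act p g) (tderiv IP IP (fun q => B.act q g) p X) =
      tderiv IP IM B.proj p X := by
  rw [← tderiv_comp (B.mdifferentiable_proj _) (B.mdifferentiable_act_right g p)]
  simp only [B.proj_act]

theorem tderiv_proj_fundVec (p : P) (A : EG) : tderiv IP IM B.proj p (B.fundVec p A) = 0 := by
  have := tderiv_comp_of_eq (B.mdifferentiable_proj p) (B.mdifferentiable_orbit p 1) (B.act_one p)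
  simp only [B.proj_act, tderiv_const] at this
  exact (congrArg (fun L : EG →L[ℝ] EM => L A) this).symm

variable [LieGroup IG ∞ G]

theorem mdifferentiableAt_coord (hU : IsOpen U) (hf : ∀ x ∈ U, B.proj (f x) = x)
    (hfs : ContMDiffOn IM IP ∞ f U) {p : P} (hp : B.proj p ∈ U) :
    MDifferentiableAt IP IG (B.coord f) p :=
  (contMDiffAt_coord hU hf hfs hp).mdifferentiableAt (by simp)

theorem leftLogDeriv_coord_act (hU : IsOpen U) (hf : ∀ x ∈ U, B.proj (f x) = x)
    (hfs : ContMDiffOn IM IP ∞ f U) {p : P} (hp : B.proj p ∈ U) (g : G) (X : EP) :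
    leftLogDeriv IG IP (B.coord f) (B.act p g) (tderiv IP IP (fun q => B.act q g) p X) =
      Ad IG g⁻¹ (leftLogDeriv IG IP (B.coord f) p X) := by
  rw [← leftLogDeriv_comp (mdifferentiableAt_coord hU hf hfs (by rwa [B.proj_act]))
    (B.mdifferentiable_act_right g p), ← leftLogDeriv_mul_const g
    (mdifferentiableAt_coord hU hf hfs hp)]
  have : (fun q => B.coord f (B.act q g)) =ᶠ[𝓝 p] fun q => B.coord f q * g := by
    filter_upwards [(hU.preimage B.contMDiff_proj.continuous).mem_nhds hp] with q hq
      using coord_act hf hq g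
  rw [leftLogDeriv_congr this]

theorem leftLogDeriv_coord_fundVec (hU : IsOpen U) (hf : ∀ x ∈ U, B.proj (f x) = x)
    (hfs : ContMDiffOn IM IP ∞ f U) {p : P} (hp : B.proj p ∈ U) (A : EG) :
    leftLogDeriv IG IP (B.coord f) p (B.fundVec p A) = A := by
  have h := leftLogDeriv_comp (x := (1 : G)) (f := fun g => B.act p g)
    (mdifferentiableAt_coord hU hf hfs (p := B.act p 1) (by rwa [B.proj_act]))
    (B.mdifferentiable_orbit p 1) A
  simp only [coord_act hf hp] at h
  rw [leftLogDeriv_const_mul (b := fun g : G => g) _ mdifferentiableAt_id,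
    leftLogDeriv_id_one, B.act_one] at h
  exact h.symm

/-- The product rule applied to `q = f (π q) g(q)`. Uniqueness of the connection depends on this
splitting. -/
theorem tderiv_decomposition (hU : IsOpen U) (hf : ∀ x ∈ U, B.proj (f x) = x)
    (hfs : ContMDiffOn IM IP ∞ f U) {p : P} (hp : B.proj p ∈ U) (X : EP) :
    X = tderiv IP IP (fun q => B.act q (B.coord f p)) (f (B.proj p))
        (tderiv IM IP f (B.proj p) (tderiv IP IM B.proj p X)) +
      B.fundVec p (leftLogDeriv IG IP (B.coord f) p X) := by
  have hc := mdifferentiableAt_coord hU hf hfs hp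
  have hfd : MDifferentiableAt IM IP f (B.proj p) :=
    (hfs.contMDiffAt (hU.mem_nhds hp)).mdifferentiableAt (by simp)
  have hfp : MDifferentiableAt IP IP (fun q => f (B.proj q)) p :=
    MDifferentiableAt.comp p hfd (B.mdifferentiable_proj p)
  have e : (fun q : P => q) =ᶠ[𝓝 p] fun q => B.act (f (B.proj q)) (B.coord f q) := by
    filter_upwards [(hU.preimage B.contMDiff_proj.continuous).mem_nhds hp] with q hq
      using (act_coord hf hq).symm
  have h1 : X = tderiv IP IP (fun q => B.act (f (B.proj q)) (B.coord f q)) p X := by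
    rw [← tderiv_congr e, tderiv_id]; rfl
  -- Re-basing the orbit at `p` turns the derivative of the second factor into the fundamental
  -- vector of `g⁻¹ dg`.
  have h2 : ∀ h, B.act (f (B.proj p)) h = B.act p ((B.coord f p)⁻¹ * h) := fun h => by
    have := B.act_mul (f (B.proj p)) (B.coord f p) ((B.coord f p)⁻¹ * h)
    rwa [act_coord hf hp, mul_inv_cancel_left] at this
  have h3 : MDifferentiableAt IP IG (fun q => (B.coord f p)⁻¹ * B.coord f q) p :=
    mdifferentiableAt_const.group_mul hc
  refine h1.trans ?_
  rw [tderiv_comp₂ (Φ := fun q : P × G => B.act q.1 q.2) (B.mdifferentiable_act _) hfp hc]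
  simp only [h2]
  rw [tderiv_comp (g := fun q => B.act q (B.coord f p)) (B.mdifferentiable_act_right _ _) hfp,
    tderiv_comp hfd (B.mdifferentiable_proj p), leftLogDeriv_eq_tderiv hc, fundVec,
    ← ContinuousLinearMap.comp_apply (tderiv IG IP (fun g => B.act p g) 1),
    ← tderiv_comp_of_eq (B.mdifferentiable_orbit p 1) h3 (by simp)]

end PrincipalBundle
end Bundles

theorem DiffForm.plot_congr {E : Type*} [NormedAddCommGroup E] [NormedSpace ℝ E]
    {H : Type*} [TopologicalSpace H] {I : ModelWithCorners ℝ E H}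
    {M : Type*} [TopologicalSpace M] [ChartedSpace H M]
    {W : Type*} [NormedAddCommGroup W] [NormedSpace ℝ W]
    {V : Type*} [NormedAddCommGroup V] [NormedSpace ℝ V] {k : ℕ} {η η' : DiffForm I M k V}
    {N : W → M} {w : W} (h : ∀ᶠ z in 𝓝 w, η (N z) = η' (N z)) :
    η.plot N =ᶠ[𝓝 w] η'.plot N := by
  filter_upwards [h] with z hz
  have hz : η.eval (N z) = η'.eval (N z) := hz
  ext v
  rw [DiffForm.plot_apply, DiffForm.plot_apply, hz]

/-! ### Lifting local forms to the bundle -/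

section Bundles

variable {EM : Type*} [NormedAddCommGroup EM] [NormedSpace ℝ EM]
  {HM : Type*} [TopologicalSpace HM] {IM : ModelWithCorners ℝ EM HM}
  {M : Type*} [TopologicalSpace M] [ChartedSpace HM M]
  {EP : Type*} [NormedAddCommGroup EP] [NormedSpace ℝ EP]
  {HP : Type*} [TopologicalSpace HP] {IP : ModelWithCorners ℝ EP HP}
  {P : Type*} [TopologicalSpace P] [ChartedSpace HP P]
  {EG : Type*} [NormedAddCommGroup EG] [NormedSpace ℝ EG]
  {HG : Type*} [TopologicalSpace HG] {IG : ModelWithCorners ℝ EG HG}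
  {G : Type*} [TopologicalSpace G] [ChartedSpace HG G] [Group G]
  {EK : Type*} [NormedAddCommGroup EK] [NormedSpace ℝ EK]
  {HK : Type*} [TopologicalSpace HK] {IK : ModelWithCorners ℝ EK HK}
  {K : Type*} [TopologicalSpace K] [ChartedSpace HK K] [Group K]
  {𝒢 : LieCrossedModule IG G IK K}
  {W : Type*} [NormedAddCommGroup W] [NormedSpace ℝ W]

open PrincipalBundle

/-- The `1`-form `g⁻¹ η₀ g + g⁻¹ dg` on `P`, where `g` is the fibre coordinate with respect to the
section `f`. -/
def liftOne (B : PrincipalBundle IM M IP P IG G) (f : M → P)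
    (η₀ : DiffForm IM M 1 (LieAlg IG G)) : DiffForm IP P 1 (LieAlg IG G) := fun p =>
  (Ad IG (B.coord f p)⁻¹).compContinuousAlternatingMap
      ((DiffForm.pullback (I' := IP) B.proj η₀).eval p) +
    (DiffForm.pullback (I' := IP) (B.coord f) (maurerCartan IG G)).eval p

/-- The `2`-form `g⁻¹ ▷ m₀` on `P`, where `g` is the fibre coordinate with respect to the
section `f`. -/
def liftTwo (𝒢 : LieCrossedModule IG G IK K) (B : PrincipalBundle IM M IP P IG G) (f : M → P)
    (m₀ : DiffForm IM M 2 (LieAlg IK K)) : DiffForm IP P 2 (LieAlg IK K) := fun p =>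
  (𝒢.dAct (B.coord f p)⁻¹).compContinuousAlternatingMap
    ((DiffForm.pullback (I' := IP) B.proj m₀).eval p)

variable {B : PrincipalBundle IM M IP P IG G} {f : M → P} {U : Set M}
  {η₀ : DiffForm IM M 1 (LieAlg IG G)} {m₀ : DiffForm IM M 2 (LieAlg IK K)}

theorem liftOne_eval (p : P) (X : EP) : (liftOne B f η₀).eval p ![X] =
    Ad IG (B.coord f p)⁻¹ (η₀.eval (B.proj p) ![tderiv IP IM B.proj p X]) +
      leftLogDeriv IG IP (B.coord f) p X := by
  rw [← DiffForm.eval_pullback_one]; rfl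

theorem liftTwo_eval (p : P) (X Y : EP) : (liftTwo 𝒢 B f m₀).eval p ![X, Y] =
    𝒢.dAct (B.coord f p)⁻¹
      (m₀.eval (B.proj p) ![tderiv IP IM B.proj p X, tderiv IP IM B.proj p Y]) := by
  rw [← DiffForm.eval_pullback_two]; rfl

theorem liftTwo_plot {N : W → P} {w : W} (hN : MDifferentiableAt 𝓘(ℝ, W) IP N w) :
    (liftTwo 𝒢 B f m₀).plot N w = (𝒢.dAct (B.coord f (N w))⁻¹).compContinuousAlternatingMap
      (m₀.plot (fun z => B.proj (N z)) w) := by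
  ext v
  rw [vec_two_eta v, DiffForm.plot_apply_two, liftTwo_eval,
    ContinuousLinearMap.compContinuousAlternatingMap_coe, Function.comp_apply,
    DiffForm.plot_apply_two, tderiv_comp (B.mdifferentiable_proj _) hN,
    tderiv_comp (B.mdifferentiable_proj _) hN]

theorem liftOne_plot {N : W → P} {w : W} (hN : MDifferentiableAt 𝓘(ℝ, W) IP N w)
    (hc : MDifferentiableAt IP IG (B.coord f) (N w)) :
    (liftOne B f η₀).plot N w = (Ad IG (B.coord f (N w))⁻¹).compContinuousAlternatingMap
      (η₀.plot (fun z => B.proj (N z)) w) +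
      (maurerCartan IG G).plot (fun z => B.coord f (N z)) w := by
  ext v
  rw [vec_one_eta v, DiffForm.plot_apply_one, liftOne_eval, ContinuousAlternatingMap.add_apply,
    ContinuousLinearMap.compContinuousAlternatingMap_coe, Function.comp_apply,
    DiffForm.plot_apply_one, tderiv_comp (B.mdifferentiable_proj _) hN, plot_maurerCartan,
    leftLogDeriv_comp hc hN]

variable [LieGroup IG ∞ G]

section Smooth
variable [IsManifold IM ∞ M] [IM.Boundaryless] [FiniteDimensional ℝ EM]
  [IsManifold IP ∞ P] [IP.Boundaryless] [FiniteDimensional ℝ EP]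
  [IG.Boundaryless] [FiniteDimensional ℝ EG]
  (hU : IsOpen U) (hf : ∀ x ∈ U, B.proj (f x) = x) (hfs : ContMDiffOn IM IP ∞ f U)
include hU hf hfs

omit [IP.Boundaryless] [FiniteDimensional ℝ EP] [IG.Boundaryless] [FiniteDimensional ℝ EG] in
theorem liftTwo_contDiffAt [IsManifold IK ∞ K] [IK.Boundaryless] [FiniteDimensional ℝ EK]
    [FiniteDimensional ℝ W] (hm : m₀.SmoothOn U) {N : W → P} {w : W}
    (hN : ContMDiffAt 𝓘(ℝ, W) IP ∞ N w) (hw : B.proj (N w) ∈ U) :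
    ContDiffAt ℝ ∞ ((liftTwo 𝒢 B f m₀).plot N) w := by
  have hd := (contMDiffAt_iff_contMDiffAt_nhds (by simp)).1 (hN.of_le (m := 1) (by simp))
  have e : (liftTwo 𝒢 B f m₀).plot N =ᶠ[𝓝 w] fun z =>
      (𝒢.dAct (B.coord f (N z))⁻¹).compContinuousAlternatingMap
        (m₀.plot (fun z => B.proj (N z)) z) := by
    filter_upwards [hd] with z hz using liftTwo_plot (hz.mdifferentiableAt (by simp))
  refine ContDiffAt.congr_of_eventuallyEq ?_ e
  exact (hm.contDiffAt_plot hU (N := fun z => B.proj (N z))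
    (B.contMDiff_proj.contMDiffAt.comp w hN) hw).compContinuousAlternatingMap
    (𝒢.contDiffAt_dAct_inv (N := fun z => B.coord f (N z))
      ((contMDiffAt_coord hU hf hfs hw).comp w hN))

omit [IsManifold IM ∞ M] [IM.Boundaryless] [FiniteDimensional ℝ EM]
  [IP.Boundaryless] [FiniteDimensional ℝ EP]
  [IG.Boundaryless] [FiniteDimensional ℝ EG] in
theorem liftOne_plot_eventuallyEq {N : W → P} {w : W}
    (hN : ContMDiffAt 𝓘(ℝ, W) IP ∞ N w) (hw : B.proj (N w) ∈ U) :
    (liftOne B f η₀).plot N =ᶠ[𝓝 w] fun z =>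
      (Ad IG (B.coord f (N z))⁻¹).compContinuousAlternatingMap
        (η₀.plot (fun z => B.proj (N z)) z) +
      (maurerCartan IG G).plot (fun z => B.coord f (N z)) z := by
  have hd := (contMDiffAt_iff_contMDiffAt_nhds (by simp)).1 (hN.of_le (m := 1) (by simp))
  filter_upwards [hd, hN.continuousAt.preimage_mem_nhds
    ((hU.preimage B.contMDiff_proj.continuous).mem_nhds hw)] with z hz hzU
  exact liftOne_plot (hz.mdifferentiableAt (by simp)) (mdifferentiableAt_coord hU hf hfs hzU)

omit [IP.Boundaryless] [FiniteDimensional ℝ EP] in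
theorem liftOne_contDiffAt [FiniteDimensional ℝ W] (hη : η₀.SmoothOn U) {N : W → P} {w : W}
    (hN : ContMDiffAt 𝓘(ℝ, W) IP ∞ N w) (hw : B.proj (N w) ∈ U) :
    ContDiffAt ℝ ∞ ((liftOne B f η₀).plot N) w := by
  refine ContDiffAt.congr_of_eventuallyEq ?_ (liftOne_plot_eventuallyEq hU hf hfs hN hw)
  have hc : ContMDiffAt 𝓘(ℝ, W) IG ∞ (fun z => B.coord f (N z)) w :=
    (contMDiffAt_coord hU hf hfs hw).comp w hN
  exact ((hη.contDiffAt_plot hU (N := fun z => B.proj (N z))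
    (B.contMDiff_proj.contMDiffAt.comp w hN) hw).compContinuousAlternatingMap
    (contDiffAt_Ad_inv hc)).add (contDiffAt_plot_maurerCartan hc)

theorem liftOne_smoothOn (hη : η₀.SmoothOn U) :
    (liftOne B f η₀).SmoothOn (B.proj ⁻¹' U) :=
  DiffForm.smoothOn_of_contDiffAt fun p _ hy hyU =>
    liftOne_contDiffAt hU hf hfs hη (contMDiffAt_extChartAt_symm p hy) hyU

/-- The structure equation for the lifted form. -/
theorem liftOne_d (hη : η₀.SmoothOn U) {p : P} (hp : B.proj p ∈ U) (X Y : EP) :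
    (liftOne B f η₀).d.eval p ![X, Y] + lieBr (G := G) IG ((liftOne B f η₀).eval p ![X])
      ((liftOne B f η₀).eval p ![Y]) =
    Ad IG (B.coord f p)⁻¹ (localCurvature (IG := IG) (G := G) η₀ (B.proj p)
      (tderiv IP IM B.proj p X) (tderiv IP IM B.proj p Y)) := by
  have : CompleteSpace EG := FiniteDimensional.complete ℝ EG
  -- The plot used is the inverse chart at `p`: its derivative at the base point is the identity, so
  -- the structure equation for the plot is the pointwise statement at `p`.
  have hN := contMDiffAt_extChartAt_symm p (mem_extChartAt_target (I := IP) p)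
  have hNp := extChartAt_to_inv (I := IP) p
  have hNd := tderiv_extChartAt_symm (I := IP) p
  set N := (extChartAt IP p).symm
  set w := extChartAt IP p p
  have hw : B.proj (N w) ∈ U := by rwa [hNp]
  have hpN : ContMDiffAt 𝓘(ℝ, EP) IM ∞ (fun z => B.proj (N z)) w :=
    B.contMDiff_proj.contMDiffAt.comp w hN
  have key := structure_equation
    (ContMDiffAt.comp w (contMDiffAt_coord hU hf hfs hw) hN)
    (hη.contDiffAt_plot hU hpN hw) (liftOne_plot_eventuallyEq hU hf hfs hN hw) X Y
  rw [DiffForm.extDeriv_plot hη hU hpN hw,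
    DiffForm.extDeriv_plot (liftOne_smoothOn hU hf hfs hη)
      (hU.preimage B.contMDiff_proj.continuous) hN hw] at key
  have hd1 := DiffForm.plot_apply_two N (η := (liftOne B f η₀).d) w X Y
  have hd2 := DiffForm.plot_apply_two (fun z => B.proj (N z)) (η := η₀.d) w X Y
  simp only [DiffForm.plot_apply_one] at key
  have hpd : tderiv 𝓘(ℝ, EP) IM (fun z => B.proj (N z)) w = tderiv IP IM B.proj p := by
    rw [tderiv_comp_of_eq (B.mdifferentiable_proj p) (hN.mdifferentiableAt (by simp)) hNp, hNd,
      ContinuousLinearMap.comp_id]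
  rw [hNd, hNp] at hd1
  rw [hpd, hNp] at hd2
  rw [hpd, hNd, hNp] at key
  simp only [Function.comp_apply, hNp, ContinuousLinearMap.id_apply] at key
  rw [localCurvature_eq]
  exact (congrArg (· + _) hd1.symm).trans (key.trans (congrArg (fun a => Ad IG _ (a + _)) hd2))

end Smooth

section Transition
variable {f' : M → P} {U' : Set M} {φ : M → G} {η₀' : DiffForm IM M 1 (LieAlg IG G)}
  {m₀' : DiffForm IM M 2 (LieAlg IK K)}

omit [LieGroup IG ∞ G] in
theorem coord_transition (hf : ∀ x ∈ U, B.proj (f x) = x) (hf' : ∀ x ∈ U', B.proj (f' x) = x)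
    (hφ : ∀ x ∈ U ∩ U', B.act (f x) (φ x) = f' x) {p : P} (hp : B.proj p ∈ U ∩ U') :
    B.coord f p = φ (B.proj p) * B.coord f' p := by
  apply B.act_left_injective (f (B.proj p))
  rw [act_coord hf hp.1, B.act_mul, hφ _ hp, act_coord hf' hp.2]

omit [LieGroup IG ∞ G] in
theorem liftTwo_transition (hf : ∀ x ∈ U, B.proj (f x) = x)
    (hf' : ∀ x ∈ U', B.proj (f' x) = x) (hφ : ∀ x ∈ U ∩ U', B.act (f x) (φ x) = f' x)
    (hm : ∀ x ∈ U ∩ U', ∀ X Y : EM,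
      m₀'.eval x ![X, Y] = 𝒢.dAct (φ x)⁻¹ (m₀.eval x ![X, Y]))
    {p : P} (hp : B.proj p ∈ U ∩ U') : liftTwo 𝒢 B f m₀ p = liftTwo 𝒢 B f' m₀' p := by
  apply DiffForm.ext_eval
  ext v
  rw [vec_two_eta v, liftTwo_eval, liftTwo_eval, hm _ hp, ← 𝒢.dAct_mul,
    coord_transition hf hf' hφ hp, mul_inv_rev]

/-- Insert `g = φ g'` into `g⁻¹ dg`: the product rule yields `g'⁻¹ (φ⁻¹ dφ) g' + g'⁻¹ dg'`, and the
first term is what the change of gauge adds to `η₀`. -/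
theorem liftOne_transition (hU : IsOpen U) (hf : ∀ x ∈ U, B.proj (f x) = x)
    (hfs : ContMDiffOn IM IP ∞ f U) (hU' : IsOpen U') (hf' : ∀ x ∈ U', B.proj (f' x) = x)
    (hfs' : ContMDiffOn IM IP ∞ f' U') (hφ : ∀ x ∈ U ∩ U', B.act (f x) (φ x) = f' x)
    (hη : ∀ x ∈ U ∩ U', ∀ X : EM, η₀'.eval x ![X] =
      Ad IG (φ x)⁻¹ (η₀.eval x ![X]) + leftLogDeriv IG IM φ x X)
    {p : P} (hp : B.proj p ∈ U ∩ U') : liftOne B f η₀ p = liftOne B f' η₀' p := by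
  have hφd : MDifferentiableAt IM IG φ (B.proj p) := by
    -- Differentiability of `φ` is not assumed; it holds because `φ` is the coordinate of the
    -- section `f'` with respect to `f`.
    have h1 : MDifferentiableAt IM IG (fun x => B.coord f (f' x)) (B.proj p) := by
      refine MDifferentiableAt.comp _ (mdifferentiableAt_coord hU hf hfs ?_)
        ((hfs'.contMDiffAt (hU'.mem_nhds hp.2)).mdifferentiableAt (by simp))
      rw [hf' _ hp.2]; exact hp.1
    refine h1.congr_of_eventuallyEq ?_
    filter_upwards [(hU.inter hU').mem_nhds hp] with x hx
    rw [coord_transition hf hf' hφ (p := f' x) (by rwa [hf' _ hx.2]), coord_section hf' hx.2,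
      hf' _ hx.2, mul_one]
  have hφp : MDifferentiableAt IP IG (fun q => φ (B.proj q)) p :=
    MDifferentiableAt.comp p hφd (B.mdifferentiable_proj p)
  have e : B.coord f =ᶠ[𝓝 p] fun q => φ (B.proj q) * B.coord f' q := by
    filter_upwards [((hU.inter hU').preimage B.contMDiff_proj.continuous).mem_nhds hp] with q hq
      using coord_transition hf hf' hφ hq
  apply DiffForm.ext_eval
  ext v
  rw [vec_one_eta v, liftOne_eval, liftOne_eval, hη _ hp, leftLogDeriv_congr e,
    leftLogDeriv_mul hφp (mdifferentiableAt_coord hU' hf' hfs' hp.2),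
    leftLogDeriv_comp hφd (B.mdifferentiable_proj p), map_add, ← Ad_mul,
    coord_transition hf hf' hφ hp, mul_inv_rev, add_assoc]

end Transition

/-! ### The local form determines the connection -/

section Uniqueness
variable (hU : IsOpen U) (hf : ∀ x ∈ U, B.proj (f x) = x) (hfs : ContMDiffOn IM IP ∞ f U)
include hU hf hfs

/-- Split the vector by `tderiv_decomposition`: equivariance and the local form give the value on
the translated section direction, and `η(A^#) = A` the value on the vertical one. -/
theorem CategoricalConnection.η_eq_liftOne {c : CategoricalConnection 𝒢 B}
    (hc : c.HasLocalForm U f η₀ m₀) {p : P} (hp : B.proj p ∈ U) : c.η p = liftOne B f η₀ p := by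
  have heq : ∀ (g : G) (p : P) (X : EP),
      c.η.eval (B.act p g) ![tderiv IP IP (fun q => B.act q g) p X] =
      Ad IG g⁻¹ (c.η.eval p ![X]) := fun g p X => by
    rw [← DiffForm.eval_pullback_one (I' := IP) (fun q => B.act q g)]
    exact c.equivariant_η g p X
  have hfund : ∀ (p : P) (A : EG), c.η.eval p ![B.fundVec p A] = A := c.η_fund
  apply DiffForm.ext_eval
  ext v
  rw [vec_one_eta v, liftOne_eval]
  set X := v 0
  have hadd : ∀ X Y : EP, c.η.eval p ![X + Y] = c.η.eval p ![X] + c.η.eval p ![Y] := fun X Y =>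
    (c.η.eval p).toMultilinearMap.cons_add ![] X Y
  have h1 := heq (B.coord f p) (f (B.proj p)) (tderiv IM IP f (B.proj p) (tderiv IP IM B.proj p X))
  rw [act_coord hf hp, ← DiffForm.eval_pullback_one] at h1
  have h2 : (DiffForm.pullback (I' := IM) f c.η).eval (B.proj p) = η₀.eval (B.proj p) :=
    (hc _ hp).1
  rw [h2] at h1
  conv_lhs => rw [tderiv_decomposition hU hf hfs hp X]
  rw [hadd, h1, hfund]

theorem CategoricalConnection.m_eq_liftTwo {c : CategoricalConnection 𝒢 B}
    (hc : c.HasLocalForm U f η₀ m₀) {p : P} (hp : B.proj p ∈ U) : c.m p = liftTwo 𝒢 B f m₀ p := by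
  have heq : ∀ (g : G) (p : P) (X Y : EP), c.m.eval (B.act p g)
      ![tderiv IP IP (fun q => B.act q g) p X, tderiv IP IP (fun q => B.act q g) p Y] =
      𝒢.dAct g⁻¹ (c.m.eval p ![X, Y]) := fun g p X Y => by
    rw [← DiffForm.eval_pullback_two (I' := IP) (fun q => B.act q g)]
    exact c.equivariant_m g p X Y
  have hfund : ∀ (p : P) (A : EG), c.η.eval p ![B.fundVec p A] = A := c.η_fund
  have hhor : ∀ (p : P) (X Y : EP), c.m.eval p ![X, Y] =
      c.m.eval p ![X - B.fundVec p (c.η.eval p ![X]), Y - B.fundVec p (c.η.eval p ![Y])] :=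
    c.horizontal_m
  have hadd : ∀ X Y : EP, c.η.eval p ![X + Y] = c.η.eval p ![X] + c.η.eval p ![Y] := fun X Y =>
    (c.η.eval p).toMultilinearMap.cons_add ![] X Y
  -- Adding a fundamental vector does not change the horizontal part, and `m` depends only on
  -- horizontal parts.
  have hvert : ∀ (X Y : EP) (A A' : EG), c.m.eval p ![X + B.fundVec p A, Y + B.fundVec p A'] =
      c.m.eval p ![X, Y] := fun X Y A A' => by
    rw [hhor p (X + _), hhor p X, hadd, hadd, hfund, hfund, map_add, map_add,
      add_sub_add_right_eq_sub, add_sub_add_right_eq_sub]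
  apply DiffForm.ext_eval
  ext v
  rw [vec_two_eta v, liftTwo_eval]
  set X := v 0
  set Y := v 1
  have h1 := heq (B.coord f p) (f (B.proj p)) (tderiv IM IP f (B.proj p) (tderiv IP IM B.proj p X))
    (tderiv IM IP f (B.proj p) (tderiv IP IM B.proj p Y))
  rw [act_coord hf hp, ← DiffForm.eval_pullback_two] at h1
  have h2 : (DiffForm.pullback (I' := IM) f c.m).eval (B.proj p) = m₀.eval (B.proj p) :=
    (hc _ hp).2
  rw [h2] at h1
  conv_lhs => rw [tderiv_decomposition hU hf hfs hp X, tderiv_decomposition hU hf hfs hp Y]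
  rw [hvert, h1]

end Uniqueness

/-! ### The lifts have the prescribed local forms -/

section LocalForm
variable (hU : IsOpen U) (hf : ∀ x ∈ U, B.proj (f x) = x) (hfs : ContMDiffOn IM IP ∞ f U)
include hU hf hfs

omit [LieGroup IG ∞ G] in
theorem tderiv_proj_section {x : M} (hx : x ∈ U) (X : EM) :
    tderiv IP IM B.proj (f x) (tderiv IM IP f x X) = X := by
  rw [← tderiv_comp (B.mdifferentiable_proj _)
    ((hfs.contMDiffAt (hU.mem_nhds hx)).mdifferentiableAt (by simp))]
  have : (fun x => B.proj (f x)) =ᶠ[𝓝 x] fun x => x := by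
    filter_upwards [hU.mem_nhds hx] with y hy using hf y hy
  rw [tderiv_congr this, tderiv_id]; rfl

theorem pullback_section_liftOne {x : M} (hx : x ∈ U) :
    DiffForm.pullback (I' := IM) f (liftOne B f η₀) x = η₀ x := by
  have hfd : MDifferentiableAt IM IP f x :=
    (hfs.contMDiffAt (hU.mem_nhds hx)).mdifferentiableAt (by simp)
  have hfx : B.proj (f x) ∈ U := by rwa [hf x hx]
  have e : (fun x => B.coord f (f x)) =ᶠ[𝓝 x] fun _ => 1 := by
    filter_upwards [hU.mem_nhds hx] with y hy using coord_section hf hy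
  apply DiffForm.ext_eval
  ext v
  rw [vec_one_eta v, DiffForm.eval_pullback_one, liftOne_eval,
    tderiv_proj_section hU hf hfs hx, coord_section hf hx, hf x hx,
    ← leftLogDeriv_comp (mdifferentiableAt_coord hU hf hfs hfx) hfd, leftLogDeriv_congr e,
    leftLogDeriv_const, inv_one, Ad_one]
  simp

omit [LieGroup IG ∞ G] in
theorem pullback_section_liftTwo {x : M} (hx : x ∈ U) :
    DiffForm.pullback (I' := IM) f (liftTwo 𝒢 B f m₀) x = m₀ x := by
  apply DiffForm.ext_eval
  ext v
  rw [vec_two_eta v, DiffForm.eval_pullback_two, liftTwo_eval,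
    tderiv_proj_section hU hf hfs hx, tderiv_proj_section hU hf hfs hx, coord_section hf hx,
    hf x hx, inv_one, 𝒢.dAct_one]
  simp

end LocalForm

/-! ### Gluing the lifts to a categorical connection -/

section Glue
variable [IsManifold IM ∞ M] [IM.Boundaryless] [FiniteDimensional ℝ EM]
  [IsManifold IP ∞ P] [IP.Boundaryless] [FiniteDimensional ℝ EP]
  [IG.Boundaryless] [FiniteDimensional ℝ EG]
  [IsManifold IK ∞ K] [IK.Boundaryless] [FiniteDimensional ℝ EK]

/-- Forms on `P` that are, near every fibre, lifts of local forms with `∂(m₀)` the curvature of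
`η₀`, constitute a categorical connection. -/
theorem exists_categoricalConnection (η : DiffForm IP P 1 (LieAlg IG G))
    (m : DiffForm IP P 2 (LieAlg IK K))
    (h : ∀ p₀ : P, ∃ (U : Set M) (f : M → P) (η₀ : DiffForm IM M 1 (LieAlg IG G))
      (m₀ : DiffForm IM M 2 (LieAlg IK K)), IsOpen U ∧ B.proj p₀ ∈ U ∧
      (∀ x ∈ U, B.proj (f x) = x) ∧ ContMDiffOn IM IP ∞ f U ∧ η₀.SmoothOn U ∧ m₀.SmoothOn U ∧
      (∀ x ∈ U, ∀ X Y : EM, 𝒢.dBd (m₀.eval x ![X, Y]) =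
        localCurvature (IG := IG) (G := G) η₀ x X Y) ∧
      (∀ p, B.proj p ∈ U → η p = liftOne B f η₀ p) ∧
      ∀ p, B.proj p ∈ U → m p = liftTwo 𝒢 B f m₀ p) :
    ∃ c : CategoricalConnection 𝒢 B, c.η = η ∧ c.m = m := by
  have hfund : ∀ (p : P) (A : EG), η.eval p ![B.fundVec p A] = A := fun p A => by
    obtain ⟨U, f, η₀, m₀, hU, hp, hf, hfs, -, -, -, h1, -⟩ := h p
    have h1 : η.eval p = (liftOne B f η₀).eval p := h1 p hp
    rw [h1, liftOne_eval, tderiv_proj_fundVec, leftLogDeriv_coord_fundVec hU hf hfs hp]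
    have : η₀.eval (B.proj p) ![(0 : EM)] = 0 := (η₀.eval (B.proj p)).map_coord_zero 0 rfl
    rw [this, map_zero, zero_add]
  have hproj : ∀ (p : P) (X : EP), tderiv IP IM B.proj p (X - B.fundVec p (η.eval p ![X])) =
      tderiv IP IM B.proj p X := fun p X => by
    rw [map_sub, tderiv_proj_fundVec, sub_zero]
  have hsub : ∀ (p : P) (X Y : EP), η.eval p ![X - Y] = η.eval p ![X] - η.eval p ![Y] :=
    fun p X Y => by
      have := (η.eval p).toMultilinearMap.cons_add ![] (X - Y) Y
      rw [sub_add_cancel] at this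
      exact eq_sub_of_add_eq this.symm
  refine ⟨⟨η, m, ?_, ?_, ?_, hfund, ?_, ?_, ?_⟩, rfl, rfl⟩
  · refine DiffForm.smoothOn_of_contDiffAt fun p y hy _ => ?_
    obtain ⟨U, f, η₀, m₀, hU, hp, hf, hfs, hη, -, -, h1, -⟩ := h ((extChartAt IP p).symm y)
    have hN := contMDiffAt_extChartAt_symm p hy
    refine (liftOne_contDiffAt hU hf hfs hη hN hp).congr_of_eventuallyEq
      (DiffForm.plot_congr ?_)
    filter_upwards [hN.continuousAt.preimage_mem_nhds
      ((hU.preimage B.contMDiff_proj.continuous).mem_nhds hp)] with z hz using h1 _ hz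
  · refine DiffForm.smoothOn_of_contDiffAt fun p y hy _ => ?_
    obtain ⟨U, f, η₀, m₀, hU, hp, hf, hfs, -, hm, -, -, h1⟩ := h ((extChartAt IP p).symm y)
    have hN := contMDiffAt_extChartAt_symm p hy
    refine (liftTwo_contDiffAt (𝒢 := 𝒢) hU hf hfs hm hN hp).congr_of_eventuallyEq
      (DiffForm.plot_congr ?_)
    filter_upwards [hN.continuousAt.preimage_mem_nhds
      ((hU.preimage B.contMDiff_proj.continuous).mem_nhds hp)] with z hz using h1 _ hz
  · intro g p (X : EP)
    obtain ⟨U, f, η₀, m₀, hU, hp, hf, hfs, -, -, -, h1, -⟩ := h p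
    have hpg : B.proj (B.act p g) ∈ U := by rwa [B.proj_act]
    have e1 : η.eval p = (liftOne B f η₀).eval p := h1 p hp
    have e2 : η.eval (B.act p g) = (liftOne B f η₀).eval (B.act p g) := h1 _ hpg
    have : (DiffForm.pullback (I' := IP) (fun q => B.act q g) η).eval p ![X] =
        Ad IG g⁻¹ (η.eval p ![X]) := by
      rw [DiffForm.eval_pullback_one, e1, e2, liftOne_eval, liftOne_eval, tderiv_proj_act,
        leftLogDeriv_coord_act hU hf hfs hp, coord_act hf hp, B.proj_act, map_add, ← Ad_mul,
        mul_inv_rev]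
    exact this
  · intro g p (X : EP) (Y : EP)
    obtain ⟨U, f, η₀, m₀, hU, hp, hf, hfs, -, -, -, -, h1⟩ := h p
    have hpg : B.proj (B.act p g) ∈ U := by rwa [B.proj_act]
    have e1 : m.eval p = (liftTwo 𝒢 B f m₀).eval p := h1 p hp
    have e2 : m.eval (B.act p g) = (liftTwo 𝒢 B f m₀).eval (B.act p g) := h1 _ hpg
    have : (DiffForm.pullback (I' := IP) (fun q => B.act q g) m).eval p ![X, Y] =
        𝒢.dAct g⁻¹ (m.eval p ![X, Y]) := by
      rw [DiffForm.eval_pullback_two, e1, e2, liftTwo_eval, liftTwo_eval, tderiv_proj_act,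
        tderiv_proj_act, coord_act hf hp, B.proj_act, ← 𝒢.dAct_mul, mul_inv_rev]
    exact this
  · intro p (X : EP) (Y : EP)
    obtain ⟨U, f, η₀, m₀, hU, hp, hf, hfs, -, -, -, -, h1⟩ := h p
    have e1 : m.eval p = (liftTwo 𝒢 B f m₀).eval p := h1 p hp
    have : m.eval p ![X, Y] =
        m.eval p ![X - B.fundVec p (η.eval p ![X]), Y - B.fundVec p (η.eval p ![Y])] := by
      rw [e1, liftTwo_eval, liftTwo_eval, hproj, hproj]
    exact this
  · intro p (X : EP) (Y : EP)
    obtain ⟨U, f, η₀, m₀, hU, hp, hf, hfs, hη, -, hcurv, h1, h2⟩ := h p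
    have e1 : η.eval p = (liftOne B f η₀).eval p := h1 p hp
    have e2 : m.eval p = (liftTwo 𝒢 B f m₀).eval p := h2 p hp
    have e3 : η.d p = (liftOne B f η₀).d p := by
      refine DiffForm.d_congr ?_
      filter_upwards [(hU.preimage B.contMDiff_proj.continuous).mem_nhds hp] with q hq
        using h1 q hq
    have e3 : η.d.eval p = (liftOne B f η₀).d.eval p := e3
    have : CompleteSpace EG := FiniteDimensional.complete ℝ EG
    -- Horizontal vectors lie in the kernel of `η`. The bracket in the structure equation therefore
    -- drops out and leaves `dη(X^H, Y^H)`.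
    have hz : ∀ X : EP, η.eval p ![X - B.fundVec p (η.eval p ![X])] = 0 := fun X => by
      rw [hsub, hfund, sub_self]
    have : 𝒢.dBd (m.eval p ![X, Y]) =
        η.d.eval p ![X - B.fundVec p (η.eval p ![X]), Y - B.fundVec p (η.eval p ![Y])] := by
      have key := liftOne_d hU hf hfs hη hp (X - B.fundVec p (η.eval p ![X]))
        (Y - B.fundVec p (η.eval p ![Y]))
      have h0 : lieBr (G := G) IG (0 : EG) (0 : EG) = 0 := by
        simpa using lieBr_add IG G 0 0 0
      rw [← e1, ← e3, hz, hz, h0, add_zero, hproj, hproj, ← hcurv _ hp] at key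
      rw [key, e2, liftTwo_eval, 𝒢.dBd_dAct]
    exact this

end Glue
end Bundles

section
variable {EM : Type*} [NormedAddCommGroup EM] [NormedSpace ℝ EM] [FiniteDimensional ℝ EM]
  {HM : Type*} [TopologicalSpace HM] {IM : ModelWithCorners ℝ EM HM} [IM.Boundaryless]
  {M : Type*} [TopologicalSpace M] [ChartedSpace HM M] [IsManifold IM ∞ M]
  {EG : Type*} [NormedAddCommGroup EG] [NormedSpace ℝ EG] [FiniteDimensional ℝ EG]
  {HG : Type*} [TopologicalSpace HG] {IG : ModelWithCorners ℝ EG HG} [IG.Boundaryless]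
  {G : Type*} [TopologicalSpace G] [ChartedSpace HG G] [Group G] [LieGroup IG ∞ G]
  {EK : Type*} [NormedAddCommGroup EK] [NormedSpace ℝ EK] [FiniteDimensional ℝ EK]
  {HK : Type*} [TopologicalSpace HK] {IK : ModelWithCorners ℝ EK HK} [IK.Boundaryless]
  {K : Type*} [TopologicalSpace K] [ChartedSpace HK K] [Group K] [LieGroup IK ∞ K]
  {𝒢 : LieCrossedModule IG G IK K}
  {EP : Type*} [NormedAddCommGroup EP] [NormedSpace ℝ EP] [FiniteDimensional ℝ EP]
  {HP : Type*} [TopologicalSpace HP] {IP : ModelWithCorners ℝ EP HP} [IP.Boundaryless]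
  {P : Type*} [TopologicalSpace P] [ChartedSpace HP P] [IsManifold IP ∞ P]
  {B : PrincipalBundle IM M IP P IG G}

/-- Gluing of the local forms of a categorical connection. -/
theorem existsUnique_categoricalConnection
    {ι : Type*} (U : ι → Set M) (f : ι → M → P) (φ : ι → ι → M → G)
    (η₀ : ι → DiffForm IM M 1 (LieAlg IG G)) (m₀ : ι → DiffForm IM M 2 (LieAlg IK K))
    (hU : ∀ α, IsOpen (U α)) (hcov : (⋃ α, U α) = univ)
    (hfs : ∀ α, ContMDiffOn IM IP ∞ (f α) (U α)) (hf : ∀ α, ∀ x ∈ U α, B.proj (f α x) = x)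
    (hφ : ∀ α β, ∀ x ∈ U α ∩ U β, B.act (f α x) (φ α β x) = f β x)
    (hη : ∀ α, (η₀ α).SmoothOn (U α)) (hm : ∀ α, (m₀ α).SmoothOn (U α))
    (hcurv : ∀ α, ∀ x ∈ U α, ∀ X Y : EM, 𝒢.dBd ((m₀ α).eval x ![X, Y]) =
      localCurvature (IG := IG) (G := G) (η₀ α) x X Y)
    (hηφ : ∀ α β, ∀ x ∈ U α ∩ U β, ∀ X : EM, (η₀ β).eval x ![X] =
      Ad IG (φ α β x)⁻¹ ((η₀ α).eval x ![X]) + leftLogDeriv IG IM (φ α β) x X)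
    (hmφ : ∀ α β, ∀ x ∈ U α ∩ U β, ∀ X Y : EM,
      (m₀ β).eval x ![X, Y] = 𝒢.dAct (φ α β x)⁻¹ ((m₀ α).eval x ![X, Y])) :
    ∃! c : CategoricalConnection 𝒢 B, ∀ α, c.HasLocalForm (U α) (f α) (η₀ α) (m₀ α) := by
  have hK : IsManifold IK ∞ K := ContMDiffMul.toIsManifold
  have hcov' : ∀ x : M, ∃ α, x ∈ U α := fun x => mem_iUnion.1 (hcov ▸ mem_univ x)
  -- An arbitrary index for each base point, with no regularity in the point. By the transition
  -- lemmas the lift at `p` does not depend on it, so over each `U α` the glued form equals the lift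
  -- for the fixed index `α`.
  choose a ha using hcov'
  have h1 : ∀ α p, B.proj p ∈ U α →
      liftOne B (f (a (B.proj p))) (η₀ (a (B.proj p))) p = liftOne B (f α) (η₀ α) p :=
    fun α p hp => liftOne_transition (hU _) (hf _) (hfs _) (hU _) (hf _) (hfs _) (hφ _ _)
      (hηφ _ _) ⟨ha _, hp⟩
  have h2 : ∀ α p, B.proj p ∈ U α →
      liftTwo 𝒢 B (f (a (B.proj p))) (m₀ (a (B.proj p))) p = liftTwo 𝒢 B (f α) (m₀ α) p :=
    fun α p hp => liftTwo_transition (hf _) (hf _) (hφ _ _) (hmφ _ _) ⟨ha _, hp⟩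
  obtain ⟨c, hcη, hcm⟩ := exists_categoricalConnection (𝒢 := 𝒢) (B := B)
    (fun p => liftOne B (f (a (B.proj p))) (η₀ (a (B.proj p))) p)
    (fun p => liftTwo 𝒢 B (f (a (B.proj p))) (m₀ (a (B.proj p))) p)
    fun p₀ => ⟨U (a (B.proj p₀)), f _, η₀ _, m₀ _, hU _, ha _, hf _, hfs _, hη _, hm _, hcurv _,
      h1 _, h2 _⟩
  refine ⟨c, fun α x hx => ⟨?_, ?_⟩, fun c' hc' => ?_⟩
  · rw [← pullback_section_liftOne (η₀ := η₀ α) (hU α) (hf α) (hfs α) hx]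
    refine congrArg (fun L : EP [⋀^Fin 1]→L[ℝ] EG =>
      L.compContinuousLinearMap (tderiv IM IP (f α) x)) ?_
    rw [hcη]
    exact h1 α (f α x) (by rwa [hf α x hx])
  · rw [← pullback_section_liftTwo (𝒢 := 𝒢) (m₀ := m₀ α) (hU α) (hf α) (hfs α) hx]
    refine congrArg (fun L : EP [⋀^Fin 2]→L[ℝ] EK =>
      L.compContinuousLinearMap (tderiv IM IP (f α) x)) ?_
    rw [hcm]
    exact h2 α (f α x) (by rwa [hf α x hx])
  · ext1
    · rw [hcη]
      funext p
      exact CategoricalConnection.η_eq_liftOne (hU _) (hf _) (hfs _) (hc' _) (ha _)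
    · rw [hcm]
      funext p
      exact CategoricalConnection.m_eq_liftTwo (hU _) (hf _) (hfs _) (hc' _) (ha _)

variable (𝒢) in
/-- Forms on the base define a categorical connection on the trivial bundle. -/
theorem exists_categoricalConnection_trivialBundle (η₀ : DiffForm IM M 1 (LieAlg IG G))
    (m₀ : DiffForm IM M 2 (LieAlg IK K)) (hη : η₀.SmoothOn univ) (hm : m₀.SmoothOn univ)
    (hcurv : ∀ (x : M) (X Y : EM), 𝒢.dBd (m₀.eval x ![X, Y]) =
      localCurvature (IG := IG) (G := G) η₀ x X Y) :
    ∃ c : CategoricalConnection 𝒢 (trivialBundle IM M IG G),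
      c.HasLocalForm univ (fun x => (x, 1)) η₀ m₀ := by
  have hG : IsManifold IG ∞ G := ContMDiffMul.toIsManifold
  -- The cover has one element and its only transition function is the constant `1`, so both
  -- compatibility conditions are trivial.
  obtain ⟨c, hc, -⟩ := existsUnique_categoricalConnection (𝒢 := 𝒢)
    (B := trivialBundle IM M IG G) (fun _ : Unit => univ) (fun _ x => (x, 1)) (fun _ _ _ => 1)
    (fun _ => η₀) (fun _ => m₀) (fun _ => isOpen_univ) (iUnion_const _)
    (fun _ => (contMDiff_id.prodMk contMDiff_const).contMDiffOn) (fun _ _ _ => rfl)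
    (fun _ _ x _ => by simp [trivialBundle]) (fun _ => hη) (fun _ => hm)
    (fun _ x _ => hcurv x)
    (fun _ _ x _ X => by rw [leftLogDeriv_const, inv_one, Ad_one]; simp)
    (fun _ _ x _ X Y => by rw [inv_one, 𝒢.dAct_one]; simp)
  exact ⟨c, hc ()⟩

end

end CatConn

end

theorem mainTheorem11
    -- the smooth manifold `M`
    {EM : Type*} [NormedAddCommGroup EM] [NormedSpace ℝ EM] [FiniteDimensional ℝ EM]
    {HM : Type*} [TopologicalSpace HM] (IM : ModelWithCorners ℝ EM HM) [IM.Boundaryless]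
    (M : Type*) [TopologicalSpace M] [ChartedSpace HM M] [IsManifold IM ∞ M]
    -- the Lie groups `G` and `K`
    {EG : Type*} [NormedAddCommGroup EG] [NormedSpace ℝ EG] [FiniteDimensional ℝ EG]
    {HG : Type*} [TopologicalSpace HG] (IG : ModelWithCorners ℝ EG HG) [IG.Boundaryless]
    (G : Type*) [TopologicalSpace G] [ChartedSpace HG G] [Group G] [LieGroup IG ∞ G]
    {EK : Type*} [NormedAddCommGroup EK] [NormedSpace ℝ EK] [FiniteDimensional ℝ EK]
    {HK : Type*} [TopologicalSpace HK] (IK : ModelWithCorners ℝ EK HK) [IK.Boundaryless]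
    (K : Type*) [TopologicalSpace K] [ChartedSpace HK K] [Group K] [LieGroup IK ∞ K]
    -- the Lie crossed module `(∂ : K → G, ▷)`
    (𝒢 : CatConn.LieCrossedModule IG G IK K) :
    -- gluing of local forms on a principal bundle
    (∀ {EP : Type*} [NormedAddCommGroup EP] [NormedSpace ℝ EP] [FiniteDimensional ℝ EP]
      {HP : Type*} [TopologicalSpace HP] (IP : ModelWithCorners ℝ EP HP) [IP.Boundaryless]
      (P : Type*) [TopologicalSpace P] [ChartedSpace HP P] [IsManifold IP ∞ P]
      (B : CatConn.PrincipalBundle IM M IP P IG G)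
      {ι : Type*} (U : ι → Set M) (f : ι → M → P) (φ : ι → ι → M → G)
      (η₀ : ι → CatConn.DiffForm IM M 1 (CatConn.LieAlg IG G))
      (m₀ : ι → CatConn.DiffForm IM M 2 (CatConn.LieAlg IK K)),
      -- an open cover with smooth local sections `f α : U α → P`
      (∀ α, IsOpen (U α)) → (⋃ α, U α) = Set.univ →
      (∀ α, ContMDiffOn IM IP ∞ (f α) (U α)) → (∀ α, ∀ x ∈ U α, B.proj (f α x) = x) →
      -- the transition functions
      (∀ α β, ∀ x ∈ U α ∩ U β, B.act (f α x) (φ α β x) = f β x) →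
      -- smooth local forms with `∂(m_α) = dη_α + ½ η_α ∧^ad η_α`
      (∀ α, (η₀ α).SmoothOn (U α)) → (∀ α, (m₀ α).SmoothOn (U α)) →
      (∀ α, ∀ x ∈ U α, ∀ X Y : TangentSpace IM x,
        𝒢.dBd (m₀ α x ![X, Y]) = CatConn.localCurvature (IG := IG) (G := G) (η₀ α) x X Y) →
      -- `η_β = φ_αβ⁻¹ η_α φ_αβ + φ_αβ⁻¹ dφ_αβ`
      (∀ α β, ∀ x ∈ U α ∩ U β, ∀ X : TangentSpace IM x,
        η₀ β x ![X] = CatConn.Ad IG (φ α β x)⁻¹ (η₀ α x ![X]) +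
          CatConn.leftMC IG (φ α β x) (mfderiv IM IG (φ α β) x X)) →
      -- `m_β = φ_αβ⁻¹ ▷ m_α`
      (∀ α β, ∀ x ∈ U α ∩ U β, ∀ X Y : TangentSpace IM x,
        m₀ β x ![X, Y] = 𝒢.dAct (φ α β x)⁻¹ (m₀ α x ![X, Y])) →
      ∃! c : CatConn.CategoricalConnection 𝒢 B,
        ∀ α, c.HasLocalForm (U α) (f α) (η₀ α) (m₀ α)) ∧
    -- the trivial bundle, with its section `x ↦ (x, 1)`
    (∀ (η₀ : CatConn.DiffForm IM M 1 (CatConn.LieAlg IG G))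
      (m₀ : CatConn.DiffForm IM M 2 (CatConn.LieAlg IK K)),
      η₀.SmoothOn Set.univ → m₀.SmoothOn Set.univ →
      (∀ (x : M) (X Y : TangentSpace IM x),
        𝒢.dBd (m₀ x ![X, Y]) = CatConn.localCurvature (IG := IG) (G := G) η₀ x X Y) →
      ∃ c : CatConn.CategoricalConnection 𝒢 (CatConn.trivialBundle IM M IG G),
        c.HasLocalForm Set.univ (fun x => (x, 1)) η₀ m₀) := by
  refine ⟨?_, ?_⟩
  · intro EP _ _ _ HP _ IP _ P _ _ _ B ι U f φ η₀ m₀ hU hcov hfs hf hφ hη hm hcurv hηφ hmφ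
    -- The hypotheses concern tangent spaces and the lemma concerns model spaces. They match
    -- definitionally, and `leftLogDeriv` unfolds to `leftMC` after `mfderiv`.
    exact CatConn.existsUnique_categoricalConnection U f φ η₀ m₀ hU hcov hfs hf hφ hη hm hcurv
      hηφ hmφ
  · intro η₀ m₀ hη hm hcurv
    exact CatConn.exists_categoricalConnection_trivialBundle 𝒢 η₀ m₀ hη hm hcurv
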